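/- A \emph{Pisot number} is a real algebraic integer $\theta>1$ all of whose other conjugates have modulus less than $1$. For $\theta>1$ let $$\mu_\theta=\mathop{\ast}_{k\ge 0}\Bigl(\tfrac12\delta_{-\theta^{-k}}+\tfrac12\delta_{\theta^{-k}}\Bigr)$$ be the Bernoulli convolution, i.e. the distribution of the random series $\sum_{k\ge0}\pm\theta^{-k}$ with independent fair signs. Regard it as a Borel probability measure on the circle $S^1=\mathbb{R}/\mathbb{Z}$ (by reduction modulo $1$), with Fourier coefficients $$\widehat{\mu_\theta}(n)=\int e^{-2\pi i n x}\,d\mu_\theta(x)=\prod_{k\ge0}\cos(2\pi\theta^{-k}n),\qquad n\in\mathbb{Z}.$$ For $1\le p\le\infty$ let $T_{\mu_\theta}$ be the bounded operator $f\mapsto\mu_\theta*f$, $(\mu_\theta*f)(x)=\int f(x-y)\,d\mu_\theta(y)$, on the complex space $L^p(S^1)$, and let $\mathrm{sp}(T_{\mu_\theta},L^p)$ be its spectrum. Let $\theta$ be an irrational Pisot number. Then the set of limit points of the sequence $(\widehat{\mu_\theta}(n))_{n\in\mathbb{Z}}$ (the points every neighbourhood of which contains $\widehat{\mu_\theta}(n)$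 for infinitely many $n$) is countably infinite, and for every $1<p<\infty$ $$\mathrm{sp}(T_{\mu_\theta},L^p)=\mathrm{sp}(T_{\mu_\theta},L^2)=\overline{\{\widehat{\mu_\theta}(n):n\in\mathbb{Z}\}}.$$ -/

import Mathlib

open MeasureTheory Filter Topology AddCircle
open scoped ENNReal

noncomputable section

namespace BernoulliConv

/-- A Pisot number: a real algebraic integer `θ > 1` all of whose other conjugates
(complex roots of its minimal polynomial) have modulus less than `1`. -/
def IsPisot (θ : ℝ) : Prop :=
  1 < θ ∧ IsIntegral ℤ θ ∧ ∀ z ∈ (minpoly ℚ θ).aroots ℂ, z ≠ (θ : ℂ) → ‖z‖ < 1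

/-- The law of a sequence of independent fair coin tosses. -/
def coinTosses : Measure (ℕ → Bool) :=
  Measure.infinitePi fun _ => (PMF.uniformOfFintype Bool).toMeasure

instance : IsProbabilityMeasure coinTosses := by
  unfold coinTosses; infer_instance

/-- The sign `±1` encoded by a coin toss. -/
def sign (b : Bool) : ℝ := if b then 1 else -1

/-- The random series `∑ₖ ± θ⁻ᵏ`. -/
def randomSeries (θ : ℝ) (ω : ℕ → Bool) : ℝ := ∑' k : ℕ, sign (ω k) * θ⁻¹ ^ k

/-- The Bernoulli convolution on the line, i.e. the infinite convolution over `k ≥ 0` of the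
measures `(δ_{-θ⁻ᵏ} + δ_{θ⁻ᵏ}) / 2`: the law of a sum of independent random variables having
these laws. -/
def bernoulliConvolution (θ : ℝ) : Measure ℝ := coinTosses.map (randomSeries θ)

/-- The measure induced on the circle `ℝ / ℤ`. -/
def circleBernoulli (θ : ℝ) : Measure UnitAddCircle :=
  (bernoulliConvolution θ).map (fun x : ℝ => (x : UnitAddCircle))

theorem abs_sign (b : Bool) : |sign b| = 1 := by cases b <;> simp [sign]

theorem measurable_randomSeries (θ : ℝ) : Measurable (randomSeries θ) := by
  have hs : ∀ (ω : ℕ → Bool) (k : ℕ), ‖sign (ω k) * θ⁻¹ ^ k‖ = |θ⁻¹| ^ k := fun ω k => by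
    rw [norm_mul, Real.norm_eq_abs, abs_sign, one_mul, norm_pow, Real.norm_eq_abs]
  by_cases h : |θ⁻¹| < 1
  · refine Continuous.measurable (continuous_tsum (u := fun k => |θ⁻¹| ^ k) (fun k => ?_)
      (summable_geometric_of_lt_one (abs_nonneg _) h) (fun k ω => (hs ω k).le))
    exact ((continuous_of_discreteTopology (f := sign)).comp (continuous_apply k)).mul
      continuous_const
  · have : randomSeries θ = fun _ => 0 := by
      funext ω
      refine tsum_eq_zero_of_not_summable fun hsum => h ?_
      have h1 := hsum.norm
      simp only [hs] at h1
      simpa using summable_geometric_iff_norm_lt_one.1 h1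
    rw [this]
    exact measurable_const

instance (θ : ℝ) : IsProbabilityMeasure (bernoulliConvolution θ) :=
  Measure.isProbabilityMeasure_map (measurable_randomSeries θ).aemeasurable

instance (θ : ℝ) : IsProbabilityMeasure (circleBernoulli θ) :=
  Measure.isProbabilityMeasure_map (AddCircle.measurable_mk').aemeasurable

/-- The `n`-th Fourier coefficient `∫ e^{-2πinx} dν(x)` of a measure on the circle. -/
def measureFourierCoeff (ν : Measure UnitAddCircle) (n : ℤ) : ℂ := ∫ x, fourier (-n) x ∂ν

/-- The Fourier coefficients of the Bernoulli convolution are `∏_{k ≥ 0} cos (2π θ⁻ᵏ n)`. -/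
theorem tendsto_prod_cos {θ : ℝ} (hθ : 1 < θ) (n : ℤ) :
    Tendsto (fun N : ℕ => ∏ k ∈ Finset.range N, (Real.cos (2 * Real.pi * θ⁻¹ ^ k * n) : ℂ)) atTop
      (𝓝 (measureFourierCoeff (circleBernoulli θ) n)) := by
  let e : ℝ → ℂ := fun x => Complex.exp (-(2 * Real.pi * n * x) * Complex.I)
  have hc : Continuous e := by fun_prop
  have hm : ∀ k : ℕ, Measurable fun b : Bool => e (sign b * θ⁻¹ ^ k) :=
    fun k => measurable_of_countable _
  have h0 : measureFourierCoeff (circleBernoulli θ) n =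
      ∫ ω, e (randomSeries θ ω) ∂coinTosses := by
    unfold measureFourierCoeff circleBernoulli bernoulliConvolution
    rw [integral_map AddCircle.measurable_mk'.aemeasurable
      (fourier (-n)).continuous.aestronglyMeasurable,
      integral_map (f := fun x : ℝ => fourier (-n) (x : UnitAddCircle))
        (measurable_randomSeries θ).aemeasurable
        ((fourier (-n)).continuous.comp (AddCircle.continuous_mk' 1)).aestronglyMeasurable]
    congr 1; funext ω
    rw [fourier_coe_apply]; congr 1; push_cast; ring
  have hpart : ∀ N : ℕ, (∏ k ∈ Finset.range N, (Real.cos (2 * Real.pi * θ⁻¹ ^ k * n) : ℂ)) =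
      ∫ ω, ∏ k ∈ Finset.range N, e (sign (ω k) * θ⁻¹ ^ k) ∂coinTosses := by
    intro N
    have hi := ProbabilityTheory.iIndepFun_infinitePi
      (P := fun _ : ℕ => (PMF.uniformOfFintype Bool).toMeasure)
      (X := fun (k : ℕ) b => e (sign b * θ⁻¹ ^ k)) hm
    have h1 := (hi.precomp (g := fun i : Fin N => (i : ℕ))
      Fin.val_injective).integral_fun_prod_eq_prod_integral
      (fun i => ((hm i).comp (measurable_pi_apply _)).aestronglyMeasurable)
    simp only [Finset.prod_range]
    refine Eq.trans (Finset.prod_congr rfl fun i _ => ?_) h1.symm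
    refine Eq.trans ?_ (integral_map (μ := coinTosses) (φ := fun ω => ω (i : ℕ))
      (measurable_pi_apply _).aemeasurable (hm i).aestronglyMeasurable)
    rw [coinTosses, Measure.infinitePi_map_eval, PMF.integral_eq_sum]
    simp [e, sign, Complex.cos]
    ring_nf
  rw [h0]
  simp only [hpart]
  refine tendsto_integral_of_dominated_convergence (fun _ => 1) (fun N => ?_)
    (integrable_const _) (fun N => ?_) ?_
  · exact (Finset.measurable_fun_prod _ fun k _ =>
      (hm k).comp (measurable_pi_apply k)).aestronglyMeasurable
  · filter_upwards with ω
    rw [norm_prod]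
    refine Finset.prod_le_one (fun _ _ => norm_nonneg _) fun k _ => le_of_eq ?_
    simp only [e]
    rw [Complex.norm_exp]
    simp [← Complex.ofReal_pow, ← Complex.ofReal_mul]
  · filter_upwards with ω
    have hs : Summable (fun k => sign (ω k) * θ⁻¹ ^ k) := by
      refine Summable.of_norm ?_
      have : (fun k => ‖sign (ω k) * θ⁻¹ ^ k‖) = fun k => θ⁻¹ ^ k := by
        funext k
        rw [norm_mul, Real.norm_eq_abs, abs_sign, one_mul, Real.norm_of_nonneg (by positivity)]
      rw [this]
      exact summable_geometric_of_lt_one (by positivity) (inv_lt_one_of_one_lt₀ hθ)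
    refine ((hc.tendsto _).comp hs.hasSum.tendsto_sum_nat).congr fun N => ?_
    simp only [Function.comp, e, ← Complex.exp_sum]
    push_cast
    rw [Finset.mul_sum, ← Finset.sum_neg_distrib, Finset.sum_mul]

/-- The limit points of a doubly infinite sequence: the points every neighbourhood of which
contains `a n` for infinitely many indices `n`. -/
def limitPoints (a : ℤ → ℂ) : Set ℂ := {z | ∀ U ∈ 𝓝 z, {n : ℤ | a n ∈ U}.Infinite}

/-- The convolution of a measure and a function on the circle. -/
def conv (ν : Measure UnitAddCircle) (f : UnitAddCircle → ℂ) (x : UnitAddCircle) : ℂ :=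
  ∫ y, f (x - y) ∂ν

/-- Complex `L^p` of the circle, with respect to the normalized Lebesgue measure. -/
abbrev CircleLp (p : ℝ≥0∞) := Lp ℂ p (haarAddCircle : Measure UnitAddCircle)

section Convolution

variable (ν : Measure UnitAddCircle) [IsProbabilityMeasure ν]

theorem measurePreserving_diff :
    MeasurePreserving (fun z : UnitAddCircle × UnitAddCircle => z.1 - z.2)
      (haarAddCircle.prod ν) haarAddCircle :=
  measurePreserving_fst.comp (measurePreserving_sub_prod haarAddCircle ν)

variable {ν}

theorem conv_congr {f g : UnitAddCircle → ℂ} (h : f =ᵐ[haarAddCircle] g) :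
    conv ν f =ᵐ[haarAddCircle] conv ν g := by
  have h1 := Measure.ae_ae_of_ae_prod
    ((measurePreserving_diff ν).quasiMeasurePreserving.ae_eq_comp h)
  filter_upwards [h1] with x hx
  exact integral_congr_ae hx

theorem memLp_diff {p : ℝ≥0∞} {f : UnitAddCircle → ℂ} (hf : MemLp f p haarAddCircle) :
    MemLp (fun z : UnitAddCircle × UnitAddCircle => f (z.1 - z.2)) p (haarAddCircle.prod ν) :=
  hf.comp_measurePreserving (measurePreserving_diff ν)

theorem ae_integrable_diff {p : ℝ≥0∞} (hp : 1 ≤ p) {f : UnitAddCircle → ℂ}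
    (hf : MemLp f p haarAddCircle) :
    ∀ᵐ x ∂(haarAddCircle : Measure UnitAddCircle), Integrable (fun y => f (x - y)) ν :=
  ((memLp_diff (ν := ν) hf).integrable hp).prod_right_ae

theorem eLpNorm_conv_le {p : ℝ≥0∞} (hp : 1 ≤ p) {f : UnitAddCircle → ℂ}
    (hf : MemLp f p haarAddCircle) :
    eLpNorm (conv ν f) p haarAddCircle ≤ eLpNorm f p haarAddCircle := by
  have hF := memLp_diff (ν := ν) hf
  have hn := eLpNorm_comp_measurePreserving (p := p) hf.1 (measurePreserving_diff ν)
  rcases eq_or_ne p ∞ with rfl | hpt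
  · rw [eLpNorm_exponent_top, eLpNorm_exponent_top]
    rw [eLpNorm_exponent_top, eLpNorm_exponent_top] at hn
    refine eLpNormEssSup_le_of_ae_enorm_bound ?_
    have h1 := Measure.ae_ae_of_ae_prod (enorm_ae_le_eLpNormEssSup
      (f ∘ fun z : UnitAddCircle × UnitAddCircle => z.1 - z.2) (haarAddCircle.prod ν))
    rw [hn] at h1
    filter_upwards [h1] with x hx
    refine (enorm_integral_le_lintegral_enorm _).trans ?_
    refine (lintegral_mono_ae hx).trans ?_
    simp
  · have hp0 : p ≠ 0 := (zero_lt_one.trans_le hp).ne'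
    have hpos : 0 < p.toReal := ENNReal.toReal_pos hp0 hpt
    rw [← hn, eLpNorm_eq_lintegral_rpow_enorm_toReal hp0 hpt,
      eLpNorm_eq_lintegral_rpow_enorm_toReal hp0 hpt]
    refine ENNReal.rpow_le_rpow ?_ (by positivity)
    simp only [Function.comp_apply]
    rw [lintegral_prod _ (hF.1.enorm.pow_const _)]
    refine lintegral_mono_ae ?_
    filter_upwards [ae_integrable_diff (ν := ν) hp hf] with x hx
    calc ‖conv ν f x‖ₑ ^ p.toReal
        ≤ (eLpNorm (fun y => f (x - y)) 1 ν) ^ p.toReal := by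
          rw [eLpNorm_one_eq_lintegral_enorm]
          exact ENNReal.rpow_le_rpow (enorm_integral_le_lintegral_enorm _) hpos.le
      _ ≤ (eLpNorm (fun y => f (x - y)) p ν) ^ p.toReal :=
          ENNReal.rpow_le_rpow (eLpNorm_le_eLpNorm_of_exponent_le hp hx.1) hpos.le
      _ = _ := by
          rw [eLpNorm_eq_lintegral_rpow_enorm_toReal hp0 hpt, ← ENNReal.rpow_mul,
            one_div, inv_mul_cancel₀ hpos.ne', ENNReal.rpow_one]

theorem memLp_conv {p : ℝ≥0∞} (hp : 1 ≤ p) {f : UnitAddCircle → ℂ}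
    (hf : MemLp f p haarAddCircle) : MemLp (conv ν f) p haarAddCircle :=
  ⟨(memLp_diff (ν := ν) hf).1.integral_prod_right',
    (eLpNorm_conv_le hp hf).trans_lt hf.2⟩

end Convolution

/-- The convolution operator `f ↦ ν * f` on `L^p` of the circle. -/
def convOp (ν : Measure UnitAddCircle) [IsProbabilityMeasure ν] (p : ℝ≥0∞) [hp : Fact (1 ≤ p)] :
    CircleLp p →L[ℂ] CircleLp p :=
  LinearMap.mkContinuous
    { toFun := fun f => (memLp_conv (ν := ν) hp.out (Lp.memLp f)).toLp (conv ν f)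
      map_add' := fun f g => by
        rw [← MemLp.toLp_add, MemLp.toLp_eq_toLp_iff]
        refine (conv_congr (Lp.coeFn_add f g)).trans ?_
        filter_upwards [ae_integrable_diff (ν := ν) hp.out (Lp.memLp f),
          ae_integrable_diff (ν := ν) hp.out (Lp.memLp g)] with x h1 h2
        exact integral_add h1 h2
      map_smul' := fun c f => by
        rw [RingHom.id_apply, ← MemLp.toLp_const_smul, MemLp.toLp_eq_toLp_iff]
        refine (conv_congr (Lp.coeFn_smul c f)).trans ?_
        filter_upwards with x
        exact integral_const_mul c _ }
    1 fun f => by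
      rw [one_mul]
      change ‖(memLp_conv (ν := ν) hp.out (Lp.memLp f)).toLp (conv ν f)‖ ≤ ‖f‖
      rw [Lp.norm_toLp, Lp.norm_def]
      exact ENNReal.toReal_mono (Lp.eLpNorm_ne_top f) (eLpNorm_conv_le hp.out (Lp.memLp f))

/-- The convolution operator is given almost everywhere by the convolution integral. -/
theorem coeFn_convOp (ν : Measure UnitAddCircle) [IsProbabilityMeasure ν] (p : ℝ≥0∞)
    [hp : Fact (1 ≤ p)] (f : CircleLp p) : convOp ν p f =ᵐ[haarAddCircle] conv ν f :=
  (memLp_conv (ν := ν) hp.out (Lp.memLp f)).coeFn_toLp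

end BernoulliConv

end

/-! ### Real interpolation: the integration step -/

noncomputable section

namespace BernoulliConv

/-! Write `a n` for the Fourier coefficients, `T` for the convolution operator and `K` for the
closure of the range of `a`. The characters are eigenvectors, so `K` lies in the spectrum for every
`p`; the content is the reverse inclusion, which follows from the countability of `K` alone
(`spectrum_convOp_eq_closure_range`). A countable compact set has capacity zero, so there are monic
polynomials `g` of degree `D` with roots in `K` and `|g| ≤ ε ^ D` on `K`. By Parseval `‖g(T)‖ ≤ ε ^
D` on `L²`, while trivially `‖g(T)‖ ≤ 2 ^ D` on every `L^q`. Interpolation makes `‖g(T)‖` on `L^p`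
exponentially small in `D`, at a rate that can be made arbitrarily small. If `z` is a spectral point
at distance at least `d > 0` from `K`, spectral mapping gives `‖g(T)‖ ≥ |g(z)| ≥ d ^ D`, a
contradiction. Real interpolation suffices: its constants disappear when `g` is replaced by a high
power.

Countability of the limit points rests on the Pisot property (`exists_decomposition`). If `|a n| ≥
δ`, then `2nθ⁻ᵏ` is close to an integer for all but boundedly many `k ≥ 0`. Its distance `e k` to
the nearest integer, taken with sign, is carried by the recurrence of the minimal polynomial to
bounded integers, nonzero at boundedly many places. Inverting the recurrence by a summable Green
function, which exists because no conjugate has modulus one, writes `e` as a combination of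
boundedly many translates with bounded integer coefficients; the homogeneous part is a multiple of
`θ⁻ᵏ`, fixed by `e 0 = 0`. Along an ultrafilter the coefficients are constant and the translates
group into clusters that drift apart; the cosine product splits in the limit into a product over
clusters. Only countably many such products exist, and the sign is recovered at the end.

For infinitude, let `T j` now denote the trace of `θ ^ j`, an integer with summable error `T j - θ ^
j`. Then `a (m + T j) → a m * Φ`, where `Φ` is the product of `cos (2πθ^l)` over all integers `l`.
Irrationality gives `0 < |Φ| < 1`, and iterating shows that all the distinct numbers `Φ ^ (r + 1)`
are limit points. -/

theorem lintegral_rpow_mul_indicator_lt {p q y : ℝ} (hq : 0 < q) (hqp : q < p) (hy : 0 ≤ y) :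
    ∫⁻ t in Set.Ioi (0 : ℝ), (if t < y then ENNReal.ofReal (t ^ (p - 1 - q) * y ^ q) else 0) =
      ENNReal.ofReal (y ^ p / (p - q)) := by
  have h1 : ∀ t : ℝ, (if t < y then ENNReal.ofReal (t ^ (p - 1 - q) * y ^ q) else 0) =
      (Set.Iio y).indicator (fun t => ENNReal.ofReal (t ^ (p - 1 - q) * y ^ q)) t := fun t => by
    simp [Set.indicator_apply]
  simp only [h1]
  rw [lintegral_indicator measurableSet_Iio, Measure.restrict_restrict measurableSet_Iio,
    Set.Iio_inter_Ioi, restrict_Ioo_eq_restrict_Ioc]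
  have hi : IntervalIntegrable (fun t : ℝ => t ^ (p - 1 - q)) volume 0 y :=
    intervalIntegral.intervalIntegrable_rpow' (by linarith)
  rw [← ofReal_integral_eq_lintegral_ofReal
    (((intervalIntegrable_iff_integrableOn_Ioc_of_le hy).1 hi).mul_const _)]
  · rw [integral_mul_const, ← intervalIntegral.integral_of_le hy,
      integral_rpow (Or.inl (by linarith)), Real.zero_rpow (by linarith), sub_zero,
      show p - 1 - q + 1 = p - q by ring]
    congr 1
    rcases hy.eq_or_lt with rfl | hy
    · rw [Real.zero_rpow (by linarith : p ≠ 0), Real.zero_rpow hq.ne']; simp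
    · rw [div_mul_eq_mul_div, ← Real.rpow_add hy, sub_add_cancel]
  · filter_upwards [ae_restrict_mem measurableSet_Ioc] with t ht
    have := ht.1
    positivity

theorem lintegral_rpow_mul_indicator_ge {p q y : ℝ} (hp : 0 < p) (hpq : p < q) (hy : 0 ≤ y) :
    ∫⁻ t in Set.Ioi (0 : ℝ), (if t < y then 0 else ENNReal.ofReal (t ^ (p - 1 - q) * y ^ q)) =
      ENNReal.ofReal (y ^ p / (q - p)) := by
  rcases hy.eq_or_lt with rfl | hy
  · rw [Real.zero_rpow hp.ne', Real.zero_rpow (by linarith : q ≠ 0)]; simp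
  have h1 : ∀ t : ℝ, (if t < y then 0 else ENNReal.ofReal (t ^ (p - 1 - q) * y ^ q)) =
      (Set.Ici y).indicator (fun t => ENNReal.ofReal (t ^ (p - 1 - q) * y ^ q)) t := fun t => by
    by_cases h : t < y
    · simp [h]
    · simp [h, not_lt.1 h]
  simp only [h1]
  rw [lintegral_indicator measurableSet_Ici, Measure.restrict_restrict measurableSet_Ici,
    Set.inter_eq_left.2 (Set.Ici_subset_Ioi.2 hy),
    setLIntegral_congr (Ioi_ae_eq_Ici (a := y)).symm]
  rw [← ofReal_integral_eq_lintegral_ofReal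
    ((integrableOn_Ioi_rpow_of_lt (by linarith) hy).mul_const _)]
  · rw [integral_mul_const, integral_Ioi_rpow_of_lt (by linarith) hy]
    congr 1
    rw [show p - 1 - q + 1 = p - q by ring, div_mul_eq_mul_div, neg_mul, ← Real.rpow_add hy,
      sub_add_cancel, neg_div, ← div_neg, neg_sub]
  · filter_upwards [ae_restrict_mem measurableSet_Ioi] with t ht
    have : 0 < t := hy.trans ht
    positivity

/-- The integration step of real interpolation: a two-term weak-type bound at all heights gives a
strong-type bound. -/
theorem lintegral_rpow_le_of_weakType {α : Type*} [MeasurableSpace α] {μ : Measure α} [SFinite μ]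
    {F f : α → ℝ} (hF : AEMeasurable F μ) (hf : AEMeasurable f μ) (hF0 : ∀ x, 0 ≤ F x)
    (hf0 : ∀ x, 0 ≤ f x) {p q r a c : ℝ} (hq : 0 < q) (hqp : q < p) (hpr : p < r)
    (ha : 0 ≤ a) (hc : 0 ≤ c)
    (h : ∀ t > 0, μ {x | t < F x} ≤
      ENNReal.ofReal (a * t ^ (-q)) * (∫⁻ x, (if t < f x then ENNReal.ofReal (f x ^ q) else 0) ∂μ) +
      ENNReal.ofReal (c * t ^ (-r)) *
        (∫⁻ x, (if t < f x then 0 else ENNReal.ofReal (f x ^ r)) ∂μ)) :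
    ∫⁻ x, ENNReal.ofReal (F x ^ p) ∂μ ≤
      ENNReal.ofReal (p * (a / (p - q) + c / (r - p))) * ∫⁻ x, ENNReal.ofReal (f x ^ p) ∂μ := by
  -- A measurable nonnegative representative makes the region `t < f x` jointly measurable, as
  -- Tonelli requires.
  wlog hfm : Measurable f generalizing f
  · have hm : Measurable fun x => max (hf.mk f x) 0 := hf.measurable_mk.max measurable_const
    have hE : f =ᵐ[μ] fun x => max (hf.mk f x) 0 := by
      filter_upwards [hf.ae_eq_mk] with x hx
      rw [← hx, max_eq_left (hf0 x)]
    have h2 := this (f := fun x => max (hf.mk f x) 0) hm.aemeasurable (fun x => le_max_right _ _)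
      (fun t ht => by
        refine (h t ht).trans_eq ?_
        congr 2
        · exact lintegral_congr_ae (hE.mono fun x hx => by simp only [hx])
        · exact lintegral_congr_ae (hE.mono fun x hx => by simp only [hx])) hm
    refine h2.trans_eq ?_
    congr 1
    exact lintegral_congr_ae (hE.mono fun x hx => by simp only [hx])
  have hp : 0 < p := hq.trans hqp
  rw [lintegral_rpow_eq_lintegral_meas_lt_mul μ (Eventually.of_forall hF0) hF hp]
  let k₀ : ℝ → α → ℝ≥0∞ := fun t x =>
    if t < f x then ENNReal.ofReal (t ^ (p - 1 - q) * f x ^ q) else 0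
  let k₁ : ℝ → α → ℝ≥0∞ := fun t x =>
    if t < f x then 0 else ENNReal.ofReal (t ^ (p - 1 - r) * f x ^ r)
  have hset : MeasurableSet {z : ℝ × α | z.1 < f z.2} :=
    measurableSet_lt measurable_fst (hfm.comp measurable_snd)
  have hk₀ : Measurable (Function.uncurry k₀) :=
    Measurable.ite hset (((measurable_fst.pow_const _).mul
      ((hfm.comp measurable_snd).pow_const _)).ennreal_ofReal) measurable_const
  have hk₁ : Measurable (Function.uncurry k₁) :=
    Measurable.ite hset measurable_const (((measurable_fst.pow_const _).mul
      ((hfm.comp measurable_snd).pow_const _)).ennreal_ofReal)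
  have hle : ∀ t ∈ Set.Ioi (0 : ℝ), μ {x | t < F x} * ENNReal.ofReal (t ^ (p - 1)) ≤
      ENNReal.ofReal a * (∫⁻ x, k₀ t x ∂μ) + ENNReal.ofReal c * ∫⁻ x, k₁ t x ∂μ := by
    intro t ht
    have ht' : 0 < t := ht
    refine (mul_le_mul_left (h t ht) _).trans_eq ?_
    have e : ∀ s : ℝ, ENNReal.ofReal (t ^ (-s)) * ENNReal.ofReal (t ^ (p - 1)) =
        ENNReal.ofReal (t ^ (p - 1 - s)) := fun s => by
      rw [← ENNReal.ofReal_mul (by positivity), ← Real.rpow_add ht']; congr 2; ring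
    rw [add_mul, ENNReal.ofReal_mul ha, ENNReal.ofReal_mul hc, mul_right_comm,
      mul_right_comm (ENNReal.ofReal c * _), mul_assoc (ENNReal.ofReal a), e,
      mul_assoc (ENNReal.ofReal c), e, mul_assoc, mul_assoc]
    congr 2
    · rw [← lintegral_const_mul' _ _ ENNReal.ofReal_ne_top]
      refine lintegral_congr fun x => ?_
      simp only [k₀]
      split_ifs
      · rw [ENNReal.ofReal_mul (by positivity)]
      · simp
    · rw [← lintegral_const_mul' _ _ ENNReal.ofReal_ne_top]
      refine lintegral_congr fun x => ?_
      simp only [k₁]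
      split_ifs
      · simp
      · rw [ENNReal.ofReal_mul (by positivity)]
  -- After Tonelli the height is integrated first, at fixed `x`. The power of `t` is integrable at
  -- `0` because `q < p`, and for `k₁` it is integrable at infinity because `p < r`.
  have hJ₀ : ∫⁻ t in Set.Ioi (0 : ℝ), ∫⁻ x, k₀ t x ∂μ =
      ENNReal.ofReal (1 / (p - q)) * ∫⁻ x, ENNReal.ofReal (f x ^ p) ∂μ := by
    rw [lintegral_lintegral_swap hk₀.aemeasurable, ← lintegral_const_mul' _ _ ENNReal.ofReal_ne_top]
    refine lintegral_congr fun x => ?_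
    rw [lintegral_rpow_mul_indicator_lt hq hqp (hf0 x), ← ENNReal.ofReal_mul
      (by have := sub_pos.2 hqp; positivity), one_div_mul_eq_div]
  have hJ₁ : ∫⁻ t in Set.Ioi (0 : ℝ), ∫⁻ x, k₁ t x ∂μ =
      ENNReal.ofReal (1 / (r - p)) * ∫⁻ x, ENNReal.ofReal (f x ^ p) ∂μ := by
    rw [lintegral_lintegral_swap hk₁.aemeasurable, ← lintegral_const_mul' _ _ ENNReal.ofReal_ne_top]
    refine lintegral_congr fun x => ?_
    rw [lintegral_rpow_mul_indicator_ge hp hpr (hf0 x), ← ENNReal.ofReal_mul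
      (by have := sub_pos.2 hpr; positivity), one_div_mul_eq_div]
  calc _ ≤ ENNReal.ofReal p * ∫⁻ t in Set.Ioi (0 : ℝ),
        (ENNReal.ofReal a * (∫⁻ x, k₀ t x ∂μ) + ENNReal.ofReal c * ∫⁻ x, k₁ t x ∂μ) := by
        refine mul_le_mul_right ?_ _
        exact setLIntegral_mono' measurableSet_Ioi hle
    _ = _ := by
        have h0 := sub_pos.2 hqp
        have h1 := sub_pos.2 hpr
        rw [lintegral_add_left (hk₀.lintegral_prod_right.const_mul _),
          lintegral_const_mul' _ _ ENNReal.ofReal_ne_top,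
          lintegral_const_mul' _ _ ENNReal.ofReal_ne_top, hJ₀, hJ₁, ← mul_assoc, ← mul_assoc,
          ← add_mul, ← mul_assoc, ← ENNReal.ofReal_mul ha, ← ENNReal.ofReal_mul hc,
          ← ENNReal.ofReal_add (by positivity) (by positivity), ← ENNReal.ofReal_mul hp.le]
        congr 2; ring

/-! ### Interpolation of polynomials in a convolution operator -/

section Interpolation

open Polynomial

variable (ν : Measure UnitAddCircle) [IsProbabilityMeasure ν]

theorem norm_convOp_le_one (p : ℝ≥0∞) [Fact (1 ≤ p)] : ‖convOp ν p‖ ≤ 1 :=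
  LinearMap.mkContinuous_norm_le _ zero_le_one _

/-- Polynomials in the convolution operator are compatible with the inclusions of the `L^p`. -/
theorem aeval_convOp_congr {p q : ℝ≥0∞} [Fact (1 ≤ p)] [Fact (1 ≤ q)] (g : ℂ[X])
    {f : CircleLp p} {h : CircleLp q} (hfh : f =ᵐ[haarAddCircle] h) :
    aeval (convOp ν p) g f =ᵐ[haarAddCircle] aeval (convOp ν q) g h := by
  have hpow : ∀ k : ℕ, (convOp ν p ^ k) f =ᵐ[haarAddCircle] (convOp ν q ^ k) h := by
    intro k
    induction k with
    | zero => simpa using hfh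
    | succ k ih =>
      rw [pow_succ', pow_succ']
      exact (coeFn_convOp ν p _).trans ((conv_congr ih).trans (coeFn_convOp ν q _).symm)
  induction g using Polynomial.induction_on' with
  | add g₁ g₂ h₁ h₂ =>
    rw [map_add, map_add]
    refine (Lp.coeFn_add _ _).trans ((h₁.add h₂).trans (Lp.coeFn_add _ _).symm)
  | monomial k a =>
    rw [aeval_monomial, aeval_monomial, ← Algebra.smul_def, ← Algebra.smul_def]
    exact (Lp.coeFn_smul _ _).trans (((hpow k).const_smul a).trans (Lp.coeFn_smul _ _).symm)

/-- Chebyshev's inequality for `S h`: a strong-type bound gives the weak-type bound used at each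
endpoint. -/
theorem meas_norm_ge_le {q : ℝ≥0∞} [hq : Fact (1 ≤ q)] (hqt : q ≠ ∞)
    (S : CircleLp q →L[ℂ] CircleLp q) {A : ℝ} (hA : ‖S‖ ≤ A) (h : CircleLp q) {t : ℝ}
    (ht : 0 < t) :
    haarAddCircle {x | t ≤ ‖S h x‖} ≤
      ENNReal.ofReal ((A / t) ^ q.toReal) * ∫⁻ x, ‖h x‖ₑ ^ q.toReal ∂haarAddCircle := by
  have hq0 : q ≠ 0 := (zero_lt_one.trans_le hq.out).ne'
  have hqpos := ENNReal.toReal_pos hq0 hqt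
  have hA0 : 0 ≤ A := (norm_nonneg _).trans hA
  have h1 := meas_ge_le_mul_pow_eLpNorm_enorm (haarAddCircle : Measure UnitAddCircle) hq0 hqt
    (Lp.aestronglyMeasurable (S h)) (ε := ENNReal.ofReal t) (by simpa using ht) (by simp)
  have h2 : eLpNorm (S h) q haarAddCircle ≤ ENNReal.ofReal A * eLpNorm h q haarAddCircle := by
    have := (S.le_of_opNorm_le hA h)
    rw [Lp.norm_def, Lp.norm_def, ← ENNReal.toReal_ofReal hA0, ← ENNReal.toReal_mul] at this
    exact (ENNReal.toReal_le_toReal (Lp.eLpNorm_ne_top _)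
      (ENNReal.mul_ne_top ENNReal.ofReal_ne_top (Lp.eLpNorm_ne_top _))).1 this
  have h3 : {x | t ≤ ‖S h x‖} = {x | ENNReal.ofReal t ≤ ‖S h x‖ₑ} := by
    ext x
    rw [Set.mem_ofPred_eq, Set.mem_ofPred_eq, ← ofReal_norm,
      ENNReal.ofReal_le_ofReal_iff (norm_nonneg _)]
  have h4 : eLpNorm h q haarAddCircle ^ q.toReal = ∫⁻ x, ‖h x‖ₑ ^ q.toReal ∂haarAddCircle := by
    rw [eLpNorm_eq_lintegral_rpow_enorm_toReal hq0 hqt, ← ENNReal.rpow_mul, one_div,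
      inv_mul_cancel₀ hqpos.ne', ENNReal.rpow_one]
  rw [h3]
  refine h1.trans ?_
  rw [← h4, ← ENNReal.ofReal_rpow_of_nonneg (by positivity) hqpos.le,
    ← ENNReal.mul_rpow_of_nonneg _ _ hqpos.le, ← ENNReal.mul_rpow_of_nonneg _ _ hqpos.le]
  refine ENNReal.rpow_le_rpow ?_ hqpos.le
  rw [ENNReal.ofReal_div_of_pos ht, mul_comm, div_eq_mul_inv, mul_right_comm]
  exact mul_le_mul_left h2 _

/-- Real interpolation for polynomials in a convolution operator, with a free scaling
parameter `κ`. -/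
theorem norm_aeval_convOp_rpow_le {p q r : ℝ≥0∞} [hp1 : Fact (1 ≤ p)] [hq1 : Fact (1 ≤ q)]
    [hr1 : Fact (1 ≤ r)] (hqp : q < p) (hpr : p < r) (hr : r ≠ ∞) (g : ℂ[X]) {A B κ : ℝ}
    (hA : ‖aeval (convOp ν q) g‖ ≤ A) (hB : ‖aeval (convOp ν r) g‖ ≤ B) (hκ : 0 < κ) :
    ‖aeval (convOp ν p) g‖ ^ p.toReal ≤
      p.toReal * ((2 * A / κ) ^ q.toReal / (p.toReal - q.toReal) +
        (2 * B / κ) ^ r.toReal / (r.toReal - p.toReal)) * κ ^ p.toReal := by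
  have hpt : p ≠ ∞ := (hpr.trans_le le_top).ne
  have hqt : q ≠ ∞ := (hqp.trans_le le_top).ne
  have hp0 : p ≠ 0 := (zero_lt_one.trans_le hp1.out).ne'
  have hqpos := ENNReal.toReal_pos (zero_lt_one.trans_le hq1.out).ne' hqt
  have hqp' : q.toReal < p.toReal := (ENNReal.toReal_lt_toReal hqt hpt).2 hqp
  have hpr' : p.toReal < r.toReal := (ENNReal.toReal_lt_toReal hpt hr).2 hpr
  have hA0 : 0 ≤ A := (norm_nonneg _).trans hA
  have hB0 : 0 ≤ B := (norm_nonneg _).trans hB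
  set P := p.toReal with hP
  have hPpos : 0 < P := hqpos.trans hqp'
  set C := P * ((2 * A / κ) ^ q.toReal / (P - q.toReal) +
        (2 * B / κ) ^ r.toReal / (r.toReal - P)) with hC
  have hC0 : 0 ≤ C := by
    have := sub_pos.2 hqp'
    have := sub_pos.2 hpr'
    positivity
  have key : ∀ f : CircleLp p, ∫⁻ x, ENNReal.ofReal (‖aeval (convOp ν p) g f x‖ ^ P) ∂haarAddCircle
      ≤ ENNReal.ofReal C * ∫⁻ x, ENNReal.ofReal ((κ * ‖f x‖) ^ P) ∂haarAddCircle := by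
    intro f
    have hfm := (Lp.stronglyMeasurable f)
    refine lintegral_rpow_le_of_weakType (Lp.aestronglyMeasurable _).norm.aemeasurable
      (hfm.norm.measurable.const_mul κ).aemeasurable (fun _ => norm_nonneg _)
      (fun _ => by positivity) hqpos hqp' hpr' (by positivity) (by positivity) fun t ht => ?_
    -- Cut `f` at height `t / κ`. The large part is in `L^q` because the measure is finite, and the
    -- small part is bounded, hence in `L^r`.
    let E : Set UnitAddCircle := {x | t < κ * ‖f x‖}
    have hE : MeasurableSet E := measurableSet_lt measurable_const (hfm.norm.measurable.const_mul κ)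
    have hu := (Lp.memLp f).indicator hE
    have hv := (Lp.memLp f).indicator hE.compl
    have hu' := hu.mono_exponent hqp.le
    have hv' : MemLp (Eᶜ.indicator f) r haarAddCircle := by
      refine MemLp.of_bound hv.1 (t / κ) (Eventually.of_forall fun x => ?_)
      by_cases hx : x ∈ E
      · simp [hx]; positivity
      · rw [Set.indicator_of_mem (by exact hx)]
        rw [le_div_iff₀' hκ]
        exact not_lt.1 hx
    have hsum : f = hu.toLp + hv.toLp := by
      refine Lp.ext ?_
      filter_upwards [Lp.coeFn_add hu.toLp hv.toLp, hu.coeFn_toLp, hv.coeFn_toLp] with x h1 h2 h3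
      rw [h1, Pi.add_apply, h2, h3, Set.indicator_self_add_compl_apply]
    have hS : aeval (convOp ν p) g f =ᵐ[haarAddCircle] fun x =>
        aeval (convOp ν q) g hu'.toLp x + aeval (convOp ν r) g hv'.toLp x := by
      have e1 := aeval_convOp_congr ν g (f := hu.toLp) (h := hu'.toLp)
        (hu.coeFn_toLp.trans hu'.coeFn_toLp.symm)
      have e2 := aeval_convOp_congr ν g (f := hv.toLp) (h := hv'.toLp)
        (hv.coeFn_toLp.trans hv'.coeFn_toLp.symm)
      conv_lhs => rw [hsum, map_add]
      exact (Lp.coeFn_add _ _).trans (e1.add e2)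
    have hm : haarAddCircle {x | t < ‖aeval (convOp ν p) g f x‖} ≤
        haarAddCircle {x | t / 2 ≤ ‖aeval (convOp ν q) g hu'.toLp x‖} +
        haarAddCircle {x | t / 2 ≤ ‖aeval (convOp ν r) g hv'.toLp x‖} := by
      refine (measure_mono_ae ?_).trans (measure_union_le _ _)
      filter_upwards [hS] with x hx hx2
      change t < _ at hx2
      rw [hx] at hx2
      by_contra hcon
      have h1 : ‖aeval (convOp ν q) g hu'.toLp x‖ < t / 2 := not_le.1 fun h => hcon (Or.inl h)
      have h2 : ‖aeval (convOp ν r) g hv'.toLp x‖ < t / 2 := not_le.1 fun h => hcon (Or.inr h)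
      linarith [norm_add_le (aeval (convOp ν q) g hu'.toLp x) (aeval (convOp ν r) g hv'.toLp x)]
    have hscale : ∀ (s D y : ℝ), 0 < s → 0 ≤ D → 0 ≤ y →
        ENNReal.ofReal ((D / (t / 2)) ^ s) * ENNReal.ofReal (y ^ s) =
          ENNReal.ofReal ((2 * D / κ) ^ s * t ^ (-s)) * ENNReal.ofReal ((κ * y) ^ s) := by
      intro s D y hs hD hy
      rw [← ENNReal.ofReal_mul (by positivity), ← ENNReal.ofReal_mul (by positivity),
        Real.rpow_neg ht.le, ← Real.inv_rpow ht.le, ← Real.mul_rpow (by positivity) (by positivity),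
        ← Real.mul_rpow (by positivity) (by positivity),
        ← Real.mul_rpow (by positivity) (by positivity)]
      congr 2
      field_simp
    refine hm.trans (add_le_add ?_ ?_)
    · refine (meas_norm_ge_le hqt _ hA _ (half_pos ht)).trans_eq ?_
      rw [← lintegral_const_mul' _ _ ENNReal.ofReal_ne_top,
        ← lintegral_const_mul' _ _ ENNReal.ofReal_ne_top]
      refine lintegral_congr_ae ?_
      filter_upwards [hu'.coeFn_toLp] with x hx
      rw [hx]
      by_cases h : t < κ * ‖f x‖
      · rw [Set.indicator_of_mem (by exact h), if_pos h, ← hscale _ _ _ hqpos hA0 (norm_nonneg _),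
          ← ofReal_norm, ENNReal.ofReal_rpow_of_nonneg (norm_nonneg _) hqpos.le]
      · rw [Set.indicator_of_notMem (by exact h), if_neg h]
        simp [ENNReal.zero_rpow_of_pos hqpos]
    · have hrpos : 0 < r.toReal := hPpos.trans hpr'
      refine (meas_norm_ge_le hr _ hB _ (half_pos ht)).trans_eq ?_
      rw [← lintegral_const_mul' _ _ ENNReal.ofReal_ne_top,
        ← lintegral_const_mul' _ _ ENNReal.ofReal_ne_top]
      refine lintegral_congr_ae ?_
      filter_upwards [hv'.coeFn_toLp] with x hx
      rw [hx]
      by_cases h : t < κ * ‖f x‖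
      · rw [Set.indicator_of_notMem (by exact fun hn => hn h), if_pos h]
        simp [ENNReal.zero_rpow_of_pos hrpos]
      · rw [Set.indicator_of_mem (by exact h), if_neg h, ← hscale _ _ _ hrpos hB0 (norm_nonneg _),
          ← ofReal_norm, ENNReal.ofReal_rpow_of_nonneg (norm_nonneg _) hrpos.le]
  have hnorm : ∀ f : CircleLp p, ENNReal.ofReal (‖f‖ ^ P) =
      ∫⁻ x, ENNReal.ofReal (‖f x‖ ^ P) ∂haarAddCircle := by
    intro f
    rw [← ENNReal.ofReal_rpow_of_nonneg (norm_nonneg _) hPpos.le, Lp.norm_def,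
      ENNReal.ofReal_toReal (Lp.eLpNorm_ne_top _), eLpNorm_eq_lintegral_rpow_enorm_toReal hp0 hpt,
      ← ENNReal.rpow_mul, one_div, inv_mul_cancel₀ hPpos.ne', ENNReal.rpow_one]
    refine lintegral_congr fun x => ?_
    rw [← ofReal_norm, ENNReal.ofReal_rpow_of_nonneg (norm_nonneg _) hPpos.le]
  have hbound : ‖aeval (convOp ν p) g‖ ≤ (C * κ ^ P) ^ P⁻¹ := by
    refine ContinuousLinearMap.opNorm_le_bound _ (by positivity) fun f => ?_
    have h1 := key f
    simp only [Real.mul_rpow hκ.le (norm_nonneg _),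
      ENNReal.ofReal_mul (Real.rpow_nonneg hκ.le P)] at h1
    rw [lintegral_const_mul' _ _ ENNReal.ofReal_ne_top, ← hnorm, ← hnorm, ← mul_assoc,
      ← ENNReal.ofReal_mul hC0, ← ENNReal.ofReal_mul (by positivity),
      ENNReal.ofReal_le_ofReal_iff (by positivity)] at h1
    rw [← Real.rpow_le_rpow_iff (norm_nonneg _) (by positivity) hPpos,
      Real.mul_rpow (by positivity) (norm_nonneg _), ← Real.rpow_mul (by positivity),
      inv_mul_cancel₀ hPpos.ne', Real.rpow_one]
    exact h1
  calc _ ≤ ((C * κ ^ P) ^ P⁻¹) ^ P := Real.rpow_le_rpow (norm_nonneg _) hbound hPpos.le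
    _ = C * κ ^ P := by
      rw [← Real.rpow_mul (by positivity), inv_mul_cancel₀ hPpos.ne', Real.rpow_one]

end Interpolation

/-! ### Countable compact sets have capacity zero -/

section Capacity

/-- A countable compact set has capacity zero: it carries monic polynomials, with all roots in the
set, which are small on the set relative to their degree. -/
theorem exists_multiset_prod_norm_sub_le {K : Set ℂ} (hK : IsCompact K) (hc : K.Countable)
    (hne : K.Nonempty) (h1 : ∀ z ∈ K, ‖z‖ ≤ 1) {ε : ℝ} (hε : 0 < ε) :
    ∃ s : Multiset ℂ, s.card ≠ 0 ∧ (∀ x ∈ s, x ∈ K) ∧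
      ∀ z ∈ K, (s.map fun x => ‖z - x‖).prod ≤ ε ^ s.card := by
  obtain ⟨x, hx⟩ := hc.exists_eq_range hne
  have hxK : ∀ i, x i ∈ K := fun i => hx ▸ Set.mem_range_self i
  -- Square the previous polynomial and add one new root. Squaring preserves smallness per degree
  -- where it is already achieved, and the new root creates it near `x i`.
  let S : ℕ → Multiset ℂ := fun N => N.rec 0 fun i s => x i ::ₘ (s + s)
  have hS : ∀ N, S (N + 1) = x N ::ₘ (S N + S N) := fun N => rfl
  have hcard : ∀ N, (S N).card + 1 = 2 ^ N := by
    intro N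
    induction N with
    | zero => simp [S]
    | succ N ih => rw [hS, Multiset.card_cons, Multiset.card_add, pow_succ, ← ih]; ring
  have hSK : ∀ N, ∀ y ∈ S N, y ∈ K := by
    intro N
    induction N with
    | zero => simp [S]
    | succ N ih =>
      intro y hy
      rw [hS, Multiset.mem_cons, Multiset.mem_add, or_self] at hy
      rcases hy with rfl | hy
      exacts [hxK N, ih y hy]
  -- Since `K` lies in the unit disc, halving makes every factor at most `1` on `K`.
  let h : ℕ → ℂ → ℝ := fun N z => ((S N).map fun y => ‖z - y‖ / 2).prod
  have hh : ∀ N z, h (N + 1) z = ‖z - x N‖ / 2 * (h N z * h N z) := fun N z => by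
    simp only [h, hS, Multiset.map_cons, Multiset.prod_cons, Multiset.map_add, Multiset.prod_add]
  have hpos : ∀ N z, 0 ≤ h N z := fun N z =>
    Multiset.prod_map_nonneg fun y _ => by positivity
  have hcont : ∀ N, Continuous (h N) := by
    intro N
    induction N with
    | zero => simpa [h, S] using continuous_const
    | succ N ih => rw [funext (hh N)]; fun_prop
  -- `2 * δ ≤ ε` undoes the halving; `δ ≤ 1` covers the gap between the exponent `2 ^ N` and the
  -- degree `2 ^ N - 1`.
  set δ : ℝ := min (ε / 2) 1 with hδ
  have hδ0 : 0 < δ := lt_min (by positivity) one_pos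
  let V : ℕ → Set ℂ := fun N => {z | h N z < δ ^ 2 ^ N}
  have hV : ∀ N, IsOpen (V N) := fun N => isOpen_lt (hcont N) continuous_const
  have hstep : ∀ N, ∀ z ∈ K, z ∈ V N → z ∈ V (N + 1) := by
    intro N z hz hzV
    have hzV' : h N z < δ ^ 2 ^ N := hzV
    change h (N + 1) z < δ ^ 2 ^ (N + 1)
    have hd : ‖z - x N‖ / 2 ≤ 1 := by
      have := norm_sub_le z (x N)
      linarith [h1 z hz, h1 _ (hxK N)]
    rw [hh, pow_succ, pow_mul, sq]
    calc _ ≤ 1 * (h N z * h N z) :=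
          mul_le_mul_of_nonneg_right hd (mul_nonneg (hpos N z) (hpos N z))
      _ < _ := by
          rw [one_mul]
          exact mul_lt_mul'' hzV' hzV' (hpos N z) (hpos N z)
  have hmono : ∀ M N, M ≤ N → ∀ z ∈ K, z ∈ V M → z ∈ V N := by
    intro M N hMN z hz hzV
    induction N, hMN using Nat.le_induction with
    | base => exact hzV
    | succ N _ ih => exact hstep N z hz ih
  have hcover : K ⊆ ⋃ N, V (N + 1) := by
    intro z hz
    obtain ⟨i, rfl⟩ := (hx ▸ hz : z ∈ Set.range x)
    refine Set.mem_iUnion.2 ⟨i, ?_⟩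
    change h (i + 1) (x i) < _
    rw [hh]
    simp only [sub_self, norm_zero, zero_div, zero_mul]
    positivity
  obtain ⟨t, ht⟩ := hK.elim_finite_subcover (fun N => V (N + 1)) (fun N => hV (N + 1)) hcover
  let N := t.sup id + 1
  have hN : ∀ z ∈ K, h N z < δ ^ 2 ^ N := by
    intro z hz
    obtain ⟨i, hi, hzi⟩ := Set.mem_iUnion₂.1 (ht hz)
    exact hmono (i + 1) N (Nat.succ_le_succ (Finset.le_sup (f := id) hi)) z hz hzi
  refine ⟨S N, ?_, hSK N, fun z hz => ?_⟩
  · have := hcard N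
    have h2 : 2 ^ 1 ≤ 2 ^ N := Nat.pow_le_pow_right (by norm_num) (by simp [N])
    omega
  · have e : ((S N).map fun y => ‖z - y‖).prod = 2 ^ (S N).card * h N z := by
      have : (fun y => ‖z - y‖) = fun y => 2 * (‖z - y‖ / 2) := by funext y; ring
      rw [this, Multiset.prod_map_mul, Multiset.map_const', Multiset.prod_replicate]
    rw [e]
    calc _ ≤ (2 : ℝ) ^ (S N).card * δ ^ (S N).card := by
          refine mul_le_mul_of_nonneg_left ((hN z hz).le.trans ?_) (by positivity)
          exact pow_le_pow_of_le_one hδ0.le (min_le_right _ _) (by have := hcard N; omega)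
      _ = (2 * δ) ^ (S N).card := (mul_pow _ _ _).symm
      _ ≤ ε ^ (S N).card := by
          refine pow_le_pow_left₀ (by positivity) ?_ _
          linarith [min_le_left (ε / 2) 1]

end Capacity

/-! ### Spectrum of the convolution operator when the closure of its coefficients is countable -/

section Spectrum

open Polynomial

theorem conv_fourier (ν : Measure UnitAddCircle) (n : ℤ) (x : UnitAddCircle) :
    conv ν (fourier n) x = measureFourierCoeff ν n * fourier n x := by
  unfold conv measureFourierCoeff
  rw [← integral_mul_const]
  congr 1; funext y
  simp only [fourier_apply, sub_eq_add_neg, smul_add, smul_neg, toCircle_add, toCircle_neg,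
    neg_smul, Circle.coe_mul]
  ring

variable (ν : Measure UnitAddCircle) [IsProbabilityMeasure ν]

theorem norm_measureFourierCoeff_le_one (n : ℤ) : ‖measureFourierCoeff ν n‖ ≤ 1 := by
  unfold measureFourierCoeff
  refine (norm_integral_le_of_norm_le_const (C := 1) (Eventually.of_forall fun x => ?_)).trans
    (by simp)
  rw [fourier_apply, Circle.norm_coe]

theorem convOp_fourierLp (p : ℝ≥0∞) [Fact (1 ≤ p)] (n : ℤ) :
    convOp ν p (fourierLp p n) = measureFourierCoeff ν n • fourierLp p n := by
  refine Lp.ext ?_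
  refine (coeFn_convOp ν p _).trans ((conv_congr (coeFn_fourierLp p n)).trans ?_)
  filter_upwards [Lp.coeFn_smul (measureFourierCoeff ν n) (fourierLp (T := 1) p n),
    coeFn_fourierLp (T := 1) p n] with x h1 h2
  rw [h1, Pi.smul_apply, h2, conv_fourier, smul_eq_mul]

/-- Characters are nonzero eigenvectors in every `L^p`, and the spectrum is closed. -/
theorem closure_range_subset_spectrum (p : ℝ≥0∞) [Fact (1 ≤ p)] :
    closure (Set.range (measureFourierCoeff ν)) ⊆ spectrum ℂ (convOp ν p) := by
  refine closure_minimal ?_ (spectrum.isClosed _)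
  rintro _ ⟨n, rfl⟩
  rw [spectrum.mem_iff]
  intro hu
  obtain ⟨R, hR⟩ := hu.exists_left_inv
  have hz : fourierLp (T := 1) p n = 0 := by
    have h1 := congrArg (fun S : CircleLp p →L[ℂ] CircleLp p => S (fourierLp p n)) hR
    simpa [convOp_fourierLp, Algebra.algebraMap_eq_smul_one] using h1.symm
  have h2 : (fourier n : UnitAddCircle → ℂ) =ᵐ[haarAddCircle] 0 :=
    (coeFn_fourierLp p n).symm.trans (by rw [hz]; exact Lp.coeFn_zero _ _ _)
  obtain ⟨x, hx⟩ := h2.exists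
  simp [fourier_apply] at hx

theorem aeval_convOp_fourierLp (p : ℝ≥0∞) [Fact (1 ≤ p)] (g : ℂ[X]) (n : ℤ) :
    aeval (convOp ν p) g (fourierLp p n) = g.eval (measureFourierCoeff ν n) • fourierLp p n := by
  have hpow : ∀ k : ℕ, (convOp ν p ^ k) (fourierLp p n) =
      measureFourierCoeff ν n ^ k • fourierLp p n := by
    intro k
    induction k with
    | zero => simp
    | succ k ih => rw [pow_succ', mul_apply_eq_comp, ih, map_smul, convOp_fourierLp, smul_smul,
        pow_succ]
  induction g using Polynomial.induction_on' with
  | add g₁ g₂ h₁ h₂ => rw [map_add, add_apply, h₁, h₂, eval_add, add_smul]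
  | monomial k a =>
    rw [aeval_monomial, ← Algebra.smul_def, smul_apply, hpow, eval_monomial, mul_smul]

theorem fourierBasis_repr_aeval_convOp (g : ℂ[X]) (f : CircleLp 2) (n : ℤ) :
    fourierBasis.repr (aeval (convOp ν 2) g f) n =
      g.eval (measureFourierCoeff ν n) * fourierBasis.repr f n := by
  have h1 := ((fourierBasis (T := 1)).hasSum_repr f).mapL
    ((innerSL ℂ (fourierBasis n)).comp (aeval (convOp ν 2) g))
  have h2 : ∀ k, ((innerSL ℂ (fourierBasis n)).comp (aeval (convOp ν 2) g))
      (fourierBasis.repr f k • fourierBasis (T := 1) k) =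
      if k = n then g.eval (measureFourierCoeff ν n) * fourierBasis.repr f n else 0 := by
    intro k
    rw [map_smul, ContinuousLinearMap.comp_apply, coe_fourierBasis, aeval_convOp_fourierLp,
      map_smul, innerSL_apply_apply, orthonormal_iff_ite.1 orthonormal_fourier]
    by_cases h : k = n
    · subst h; simp [mul_comm]
    · simp [h, Ne.symm h]
  simp only [h2] at h1
  rw [(fourierBasis (T := 1)).repr_apply_apply]
  exact h1.unique (hasSum_ite_eq n _)

/-- Parseval: on `L²` the operator is diagonal in the Fourier basis. -/
theorem norm_aeval_convOp_two_le (g : ℂ[X]) {B : ℝ} (hB0 : 0 ≤ B)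
    (hB : ∀ n, ‖g.eval (measureFourierCoeff ν n)‖ ≤ B) : ‖aeval (convOp ν 2) g‖ ≤ B := by
  have hsq : ∀ f : CircleLp 2, HasSum (fun i => ‖fourierBasis.repr f i‖ ^ 2) (‖f‖ ^ 2) := by
    intro f
    rw [← (fourierBasis (T := 1)).repr.norm_map f]
    apply_mod_cast lp.hasSum_norm ?_ (fourierBasis.repr f)
    simp
  refine ContinuousLinearMap.opNorm_le_bound _ hB0 fun f => ?_
  refine le_of_sq_le_sq ?_ (by positivity)
  rw [mul_pow]
  refine hasSum_le (fun n => ?_) (hsq _) ((hsq f).mul_left (B ^ 2))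
  rw [fourierBasis_repr_aeval_convOp, norm_mul, mul_pow]
  have := hB n
  gcongr

/-- Spectral mapping, together with the bound of the spectral radius by the norm. -/
theorem norm_eval_le_norm_aeval_convOp {p : ℝ≥0∞} [Fact (1 ≤ p)] {z : ℂ}
    (hz : z ∈ spectrum ℂ (convOp ν p)) (g : ℂ[X]) : ‖g.eval z‖ ≤ ‖aeval (convOp ν p) g‖ := by
  have h1 : g.eval z ∈ spectrum ℂ (aeval (convOp ν p) g) :=
    spectrum.subset_polynomial_aeval _ _ ⟨z, hz, rfl⟩
  refine (spectrum.norm_le_norm_mul_of_mem h1).trans ?_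
  exact mul_le_of_le_one_right (norm_nonneg _) ContinuousLinearMap.norm_id_le

theorem norm_aeval_convOp_prod_le {p : ℝ≥0∞} [Fact (1 ≤ p)] (s : Multiset ℂ)
    (hs : ∀ x ∈ s, ‖x‖ ≤ 1) :
    ‖aeval (convOp ν p) (s.map fun x => X - C x).prod‖ ≤ 2 ^ s.card := by
  induction s using Multiset.induction_on with
  | empty =>
    rw [Multiset.map_zero, Multiset.prod_zero, map_one, Multiset.card_zero, pow_zero]
    exact ContinuousLinearMap.norm_id_le
  | cons x s ih =>
    rw [Multiset.map_cons, Multiset.prod_cons, map_mul, Multiset.card_cons, pow_succ']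
    refine (norm_mul_le _ _).trans (mul_le_mul ?_ (ih fun y hy => hs y (Multiset.mem_cons_of_mem hy))
      (norm_nonneg _) zero_le_two)
    rw [map_sub, aeval_X, aeval_C]
    refine (norm_sub_le _ _).trans ?_
    have h1 : ‖algebraMap ℂ (CircleLp p →L[ℂ] CircleLp p) x‖ ≤ 1 := by
      rw [Algebra.algebraMap_eq_smul_one, norm_smul]
      exact mul_le_one₀ (hs x (Multiset.mem_cons_self x s)) (norm_nonneg _)
        ContinuousLinearMap.norm_id_le
    linarith [norm_convOp_le_one ν p]

theorem norm_eval_multiset_prod (s : Multiset ℂ) (z : ℂ) :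
    ‖((s.map fun x => X - C x).prod).eval z‖ = (s.map fun x => ‖z - x‖).prod := by
  induction s using Multiset.induction_on with
  | empty => simp
  | cons x s ih => simp [ih]

theorem exists_pos_rpow_eq {y s : ℝ} (hy : 0 < y) (hs : s ≠ 0) : ∃ x > 0, x ^ s = y :=
  ⟨y ^ s⁻¹, by positivity, by rw [← Real.rpow_mul hy.le, inv_mul_cancel₀ hs, Real.rpow_one]⟩

/-- When endpoint norms and cutting parameter are all `M`-th powers, each interpolation term is a
fixed constant times a geometric sequence of ratio below `1`, relative to `(d ^ M) ^ p`. This is how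
the interpolation constants are beaten. -/
theorem eventually_interpolation_bound_lt {q p r a b κ d : ℝ} (ha : 0 < a) (hb : 0 < b)
    (hκ : 0 < κ) (hd : 0 < d) (h₁ : a ^ q * κ ^ (p - q) < d ^ p)
    (h₂ : b ^ r * κ ^ (p - r) < d ^ p) :
    ∀ᶠ M : ℕ in atTop, p * ((2 * a ^ M / κ ^ M) ^ q / (p - q) + (2 * b ^ M / κ ^ M) ^ r / (r - p)) *
      (κ ^ M) ^ p < (d ^ M) ^ p := by
  have key : ∀ (c t : ℝ), 0 < c → ∀ M : ℕ, (2 * c ^ M / κ ^ M) ^ t * (κ ^ M) ^ p =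
      2 ^ t * (c ^ t * κ ^ (p - t) / d ^ p) ^ M * (d ^ M) ^ p := by
    intro c t hc M
    have e : ∀ x : ℝ, 0 < x → ∀ y : ℝ, (x ^ M) ^ y = (x ^ y) ^ M := fun x hx y => by
      rw [← Real.rpow_natCast, ← Real.rpow_mul hx.le, mul_comm, Real.rpow_mul hx.le,
        Real.rpow_natCast]
    rw [Real.div_rpow (by positivity) (by positivity), Real.mul_rpow zero_le_two (by positivity),
      e c hc, e κ hκ, e κ hκ, e d hd, Real.rpow_sub hκ, div_pow, mul_pow, div_pow]
    have := Real.rpow_pos_of_pos hκ t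
    have := Real.rpow_pos_of_pos hd p
    field_simp
  have hlim : ∀ (c t : ℝ), 0 < c → c ^ t * κ ^ (p - t) < d ^ p →
      Tendsto (fun M : ℕ => 2 ^ t * (c ^ t * κ ^ (p - t) / d ^ p) ^ M) atTop (𝓝 0) := by
    intro c t hc h
    have := (tendsto_pow_atTop_nhds_zero_of_lt_one (by positivity)
      ((div_lt_one (Real.rpow_pos_of_pos hd p)).2 h)).const_mul ((2 : ℝ) ^ t)
    simpa using this
  have h3 := ((((hlim a q ha h₁).div_const (p - q)).add
    ((hlim b r hb h₂).div_const (r - p))).const_mul p)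
  simp only [zero_div, add_zero, mul_zero] at h3
  filter_upwards [h3.eventually_lt_const one_pos] with M hM
  have hdp : 0 < (d ^ M) ^ p := by positivity
  calc _ = p * ((2 * a ^ M / κ ^ M) ^ q * (κ ^ M) ^ p / (p - q) +
        (2 * b ^ M / κ ^ M) ^ r * (κ ^ M) ^ p / (r - p)) := by ring
    _ = p * (2 ^ q * (a ^ q * κ ^ (p - q) / d ^ p) ^ M / (p - q) +
        2 ^ r * (b ^ r * κ ^ (p - r) / d ^ p) ^ M / (r - p)) * (d ^ M) ^ p := by
      rw [key a q ha, key b r hb]; ring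
    _ < _ := mul_lt_of_lt_one_left hdp hM

theorem spectrum_convOp_eq_closure_range
    (hc : (closure (Set.range (measureFourierCoeff ν))).Countable) (p : ℝ≥0∞) [hp1 : Fact (1 ≤ p)]
    (h1p : 1 < p) (hp : p < ∞) :
    spectrum ℂ (convOp ν p) = closure (Set.range (measureFourierCoeff ν)) := by
  refine (Set.Subset.antisymm ?_ (closure_range_subset_spectrum ν p))
  set K := closure (Set.range (measureFourierCoeff ν)) with hK
  have hK1 : ∀ z ∈ K, ‖z‖ ≤ 1 := by
    intro z hz
    have : K ⊆ Metric.closedBall 0 1 := closure_minimal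
      (by rintro _ ⟨n, rfl⟩; simpa using norm_measureFourierCoeff_le_one ν n)
      Metric.isClosed_closedBall
    simpa using this hz
  have hKc : IsCompact K := (isCompact_closedBall (0 : ℂ) 1).of_isClosed_subset isClosed_closure
    fun z hz => by simpa using hK1 z hz
  have hKn : K.Nonempty := ⟨_, subset_closure ⟨0, rfl⟩⟩
  intro z hz
  by_contra hzK
  obtain ⟨d, hd, hdK⟩ : ∃ d > 0, ∀ x ∈ K, d ≤ ‖z - x‖ := by
    obtain ⟨d, hd, hball⟩ := Metric.isOpen_iff.1 (isClosed_closure (s := Set.range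
      (measureFourierCoeff ν))).isOpen_compl z hzK
    refine ⟨d, hd, fun x hx => not_lt.1 fun h => hball ?_ hx⟩
    rwa [Metric.mem_ball, dist_comm, dist_eq_norm]
  -- The witness is the `m`-th power of the small polynomial of degree `D` given by capacity zero.
  have main : ∀ ε > 0, ∃ D : ℕ, 0 < D ∧ ∀ m : ℕ, ∃ g : ℂ[X],
      d ^ (m * D) ≤ ‖aeval (convOp ν p) g‖ ∧ ‖aeval (convOp ν 2) g‖ ≤ ε ^ (m * D) ∧
      ∀ (q : ℝ≥0∞) [Fact (1 ≤ q)], ‖aeval (convOp ν q) g‖ ≤ 2 ^ (m * D) := by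
    intro ε hε
    obtain ⟨s, hs0, hsK, hs⟩ := exists_multiset_prod_norm_sub_le hKc hc hKn hK1 hε
    refine ⟨s.card, Nat.pos_of_ne_zero hs0, fun m => ⟨((m • s).map fun x => X - C x).prod, ?_, ?_,
      fun q _ => ?_⟩⟩
    · refine le_trans ?_ (norm_eval_le_norm_aeval_convOp ν hz _)
      rw [norm_eval_multiset_prod, Multiset.map_nsmul, Multiset.prod_nsmul, mul_comm, pow_mul]
      refine pow_le_pow_left₀ (by positivity) ?_ _
      rw [← Multiset.prod_replicate, ← Multiset.map_const']
      exact Multiset.prod_map_le_prod_map₀ _ _ (fun _ _ => hd.le) fun x hx => hdK x (hsK x hx)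
    · refine norm_aeval_convOp_two_le ν _ (by positivity) fun n => ?_
      rw [norm_eval_multiset_prod, Multiset.map_nsmul, Multiset.prod_nsmul, mul_comm, pow_mul]
      exact pow_le_pow_left₀ (Multiset.prod_map_nonneg fun x _ => norm_nonneg _)
        (hs _ (subset_closure ⟨n, rfl⟩)) _
    · have := norm_aeval_convOp_prod_le ν (p := q) (m • s)
        (fun x hx => hK1 x (hsK x (Multiset.mem_of_mem_nsmul hx)))
      simpa using this
  have hfar : ∀ (D : ℕ), 0 < D → ∀ Q : ℕ → Prop, (∀ᶠ M in atTop, Q M) → ∃ m, Q (m * D) := by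
    intro D hD Q hQ
    obtain ⟨N, hN⟩ := eventually_atTop.1 hQ
    exact ⟨N, hN _ (Nat.le_mul_of_pos_right N hD)⟩
  set P := p.toReal with hP
  have hdP : 0 < d ^ P / 2 := by positivity
  have hlt : d ^ P / 2 < d ^ P := by linarith
  rcases lt_trichotomy p 2 with h2 | h2 | h2
  · have hP1 : 1 < P := by
      simpa using (ENNReal.toReal_lt_toReal ENNReal.one_ne_top hp.ne).2 h1p
    -- Endpoints `1` and `2`. First `κ` is chosen to make the trivial `L¹` bound harmless; then `ε`
    -- is chosen small enough for that `κ` at the `L²` endpoint.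
    obtain ⟨κ, hκ, hκe⟩ := exists_pos_rpow_eq (y := d ^ P / 2 / 2 ^ (1 : ℝ)) (by positivity)
      (sub_pos.2 hP1).ne'
    obtain ⟨ε, hε, hεe⟩ := exists_pos_rpow_eq (y := d ^ P / 2 / κ ^ (P - 2)) (by positivity)
      (two_ne_zero (α := ℝ))
    obtain ⟨D, hD, hDm⟩ := main ε hε
    obtain ⟨m, hm⟩ := hfar D hD _ (eventually_interpolation_bound_lt (q := 1) (p := P) (r := 2)
      zero_lt_two hε hκ hd (by rw [hκe, mul_div_cancel₀ _ (by positivity)]; exact hlt)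
      (by rw [hεe, div_mul_cancel₀ _ (by positivity)]; exact hlt))
    obtain ⟨g, hg1, hg2, hg3⟩ := hDm m
    have h4 := norm_aeval_convOp_rpow_le ν h1p h2 ENNReal.ofNat_ne_top g (hg3 1) hg2
      (pow_pos hκ (m * D))
    rw [ENNReal.toReal_one, ENNReal.toReal_ofNat] at h4
    exact absurd ((Real.rpow_le_rpow (by positivity) hg1 (by positivity)).trans h4) (not_le.2 hm)
  · subst h2
    obtain ⟨D, hD, hDm⟩ := main (d / 2) (by positivity)
    obtain ⟨g, hg1, hg2, -⟩ := hDm 1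
    have := hg1.trans hg2
    rw [one_mul] at this
    exact absurd this (not_le.2 (pow_lt_pow_left₀ (by linarith) (by positivity) hD.ne'))
  · have hP2 : 2 < P := by
      simpa using (ENNReal.toReal_lt_toReal ENNReal.ofNat_ne_top hp.ne).2 h2
    -- Endpoints `2` and `p + 1`: the upper one must be finite for the interpolation bound. Again
    -- `κ` controls the trivial endpoint and `ε` is chosen afterwards.
    obtain ⟨κ, hκ, hκe⟩ := exists_pos_rpow_eq (y := d ^ P / 2 / 2 ^ (P + 1)) (s := P - (P + 1))
      (by positivity) (by linarith)
    obtain ⟨ε, hε, hεe⟩ := exists_pos_rpow_eq (y := d ^ P / 2 / κ ^ (P - 2)) (by positivity)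
      (two_ne_zero (α := ℝ))
    obtain ⟨D, hD, hDm⟩ := main ε hε
    obtain ⟨m, hm⟩ := hfar D hD _ (eventually_interpolation_bound_lt (q := 2) (p := P) (r := P + 1)
      hε zero_lt_two hκ hd (by rw [hεe, div_mul_cancel₀ _ (by positivity)]; exact hlt)
      (by rw [hκe, mul_div_cancel₀ _ (by positivity)]; exact hlt))
    obtain ⟨g, hg1, hg2, hg3⟩ := hDm m
    have : Fact (1 ≤ p + 1) := ⟨le_add_self⟩
    have hpt1 : p + 1 ≠ ∞ := ENNReal.add_ne_top.2 ⟨hp.ne, ENNReal.one_ne_top⟩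
    have h4 := norm_aeval_convOp_rpow_le ν h2 (ENNReal.lt_add_right hp.ne one_ne_zero) hpt1 g
      hg2 (hg3 (p + 1)) (pow_pos hκ (m * D))
    rw [ENNReal.toReal_add hp.ne ENNReal.one_ne_top, ENNReal.toReal_one,
      ENNReal.toReal_ofNat] at h4
    exact absurd ((Real.rpow_le_rpow (by positivity) hg1 (by positivity)).trans h4) (not_le.2 hm)

end Spectrum

/-! ### Doubly infinite cosine products -/

section CosProd

theorem abs_prod_sub_prod_le {ι : Type*} {a b : ι → ℝ} (ha : ∀ i, |a i| ≤ 1) (hb : ∀ i, |b i| ≤ 1)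
    (s : Finset ι) : |∏ i ∈ s, a i - ∏ i ∈ s, b i| ≤ ∑ i ∈ s, |a i - b i| := by
  classical
  induction s using Finset.induction_on with
  | empty => simp
  | insert i s hi ih =>
    rw [Finset.prod_insert hi, Finset.prod_insert hi, Finset.sum_insert hi]
    have hs : |∏ i ∈ s, a i| ≤ 1 := by
      rw [Finset.abs_prod]
      exact Finset.prod_le_one (fun _ _ => abs_nonneg _) fun j _ => ha j
    calc |a i * ∏ i ∈ s, a i - b i * ∏ i ∈ s, b i|
        = |(a i - b i) * ∏ i ∈ s, a i + b i * (∏ i ∈ s, a i - ∏ i ∈ s, b i)| := by ring_nf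
      _ ≤ |a i - b i| * |∏ i ∈ s, a i| + |b i| * |∏ i ∈ s, a i - ∏ i ∈ s, b i| := by
          rw [← abs_mul, ← abs_mul]; exact abs_add_le _ _
      _ ≤ |a i - b i| * 1 + 1 * |∏ i ∈ s, a i - ∏ i ∈ s, b i| := by
          gcongr; exact hb i
      _ ≤ _ := by linarith

theorem abs_tprod_sub_tprod_le {ι : Type*} {a b : ι → ℝ} (ha : ∀ i, |a i| ≤ 1)
    (hb : ∀ i, |b i| ≤ 1) (hma : Multipliable a) (hmb : Multipliable b)
    (hs : Summable fun i => |a i - b i|) : |∏' i, a i - ∏' i, b i| ≤ ∑' i, |a i - b i| := by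
  have h1 : Tendsto (fun s : Finset ι => |∏ i ∈ s, a i - ∏ i ∈ s, b i|) atTop
      (𝓝 |∏' i, a i - ∏' i, b i|) := (hma.hasProd.sub hmb.hasProd).abs
  exact le_of_tendsto_of_tendsto' h1 hs.hasSum (abs_prod_sub_prod_le ha hb)

/-- The product `∏ₖ cos (π uₖ)` attached to a doubly infinite sequence. -/
def cosProd (u : ℤ → ℝ) : ℝ := ∏' k, Real.cos (Real.pi * u k)

theorem summable_cos_sub_one {ι : Type*} {u : ι → ℝ} (hu : Summable u) :
    Summable fun k => ‖Real.cos (Real.pi * u k) - 1‖ := by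
  refine (hu.abs.mul_left Real.pi).of_nonneg_of_le (fun _ => norm_nonneg _) fun k => ?_
  have := Real.abs_cos_sub_cos_le (Real.pi * u k) 0
  rwa [Real.cos_zero, sub_zero, abs_mul, abs_of_pos Real.pi_pos] at this

theorem multipliable_cos {ι : Type*} {u : ι → ℝ} (hu : Summable u) :
    Multipliable fun k => Real.cos (Real.pi * u k) := by
  simpa using multipliable_one_add_of_summable (summable_cos_sub_one hu)

theorem cosProd_ne_zero {u : ℤ → ℝ} (hu : Summable u)
    (h0 : ∀ k, Real.cos (Real.pi * u k) ≠ 0) : cosProd u ≠ 0 := by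
  have := tprod_one_add_ne_zero_of_summable (f := fun k => Real.cos (Real.pi * u k) - 1)
    (by simpa using h0) (summable_cos_sub_one hu)
  simpa [cosProd] using this

theorem abs_cosProd_le_abs_prod {u : ℤ → ℝ} (hu : Summable u) (s : Finset ℤ) :
    |cosProd u| ≤ ∏ k ∈ s, |Real.cos (Real.pi * u k)| := by
  classical
  refine le_of_tendsto (multipliable_cos hu).hasProd.abs ?_
  filter_upwards [eventually_ge_atTop s] with t ht
  exact Finset.prod_le_prod_of_subset_of_le_one ht (fun _ _ => abs_nonneg _)
    fun _ _ _ => Real.abs_cos_le_one _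

theorem abs_cosProd_sub_le {u v : ℤ → ℝ} (hu : Summable u) (hv : Summable v) :
    |cosProd u - cosProd v| ≤ Real.pi * ∑' k, |u k - v k| := by
  have hs := ((hu.sub hv).abs.mul_left Real.pi)
  have hle : ∀ k, |Real.cos (Real.pi * u k) - Real.cos (Real.pi * v k)| ≤
      Real.pi * |u k - v k| := fun k => by
    refine (Real.abs_cos_sub_cos_le _ _).trans_eq ?_
    rw [← mul_sub, abs_mul, abs_of_pos Real.pi_pos]
  have hs' := hs.of_nonneg_of_le (fun _ => abs_nonneg _) hle
  refine (abs_tprod_sub_tprod_le (fun _ => Real.abs_cos_le_one _) (fun _ => Real.abs_cos_le_one _)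
    (multipliable_cos hu) (multipliable_cos hv) hs').trans ?_
  rw [← tsum_mul_left]
  exact hs'.tsum_le_tsum hle hs

theorem summable_abs_mul_abs {u v : ℤ → ℝ} (hu : Summable u) (hv : Summable v) :
    Summable fun k => |u k| * |v k| := by
  refine (hu.abs.mul_right (∑' j, |v j|)).of_nonneg_of_le (fun _ => by positivity) fun k => ?_
  exact mul_le_mul_of_nonneg_left (hv.abs.le_tsum k fun _ _ => abs_nonneg _) (abs_nonneg _)

/-- Factor by factor the defect is `-sin (π u) sin (π v)`. It is small when `u` and `v` live in
different places, which is what makes distant clusters independent. -/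
theorem abs_cosProd_add_sub_mul_le {u v : ℤ → ℝ} (hu : Summable u) (hv : Summable v) :
    |cosProd (fun k => u k + v k) - cosProd u * cosProd v| ≤
      Real.pi ^ 2 * ∑' k, |u k| * |v k| := by
  have hs := (summable_abs_mul_abs hu hv).mul_left (Real.pi ^ 2)
  have hle : ∀ k, |Real.cos (Real.pi * (u k + v k)) -
      Real.cos (Real.pi * u k) * Real.cos (Real.pi * v k)| ≤ Real.pi ^ 2 * (|u k| * |v k|) := by
    intro k
    have h1 : ∀ x : ℝ, |Real.sin (Real.pi * x)| ≤ Real.pi * |x| := fun x => by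
      refine Real.abs_sin_le_abs.trans_eq ?_
      rw [abs_mul, abs_of_pos Real.pi_pos]
    rw [mul_add, Real.cos_add, sub_sub_cancel_left, abs_neg, abs_mul]
    calc _ ≤ (Real.pi * |u k|) * (Real.pi * |v k|) :=
          mul_le_mul (h1 _) (h1 _) (abs_nonneg _) (by positivity)
      _ = _ := by ring
  have hs' := hs.of_nonneg_of_le (fun _ => abs_nonneg _) hle
  have hm := (multipliable_cos hu).mul (multipliable_cos hv)
  unfold cosProd
  rw [← (multipliable_cos hu).tprod_mul (multipliable_cos hv)]
  refine (abs_tprod_sub_tprod_le (fun _ => Real.abs_cos_le_one _) (fun k => ?_)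
    (multipliable_cos (hu.add hv)) hm hs').trans ?_
  · rw [abs_mul]
    exact mul_le_one₀ (Real.abs_cos_le_one _) (abs_nonneg _) (Real.abs_cos_le_one _)
  rw [← tsum_mul_left]
  exact hs'.tsum_le_tsum hle hs

/-- This invariance is the reason for indexing by `ℤ` instead of `ℕ`. -/
theorem cosProd_shift (u : ℤ → ℝ) (j : ℤ) : cosProd (fun k => u (k - j)) = cosProd u :=
  (Equiv.subRight j).tprod_eq fun k => Real.cos (Real.pi * u k)

theorem summable_shift {u : ℤ → ℝ} (hu : Summable u) (j : ℤ) : Summable fun k => u (k - j) :=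
  (Equiv.subRight j).summable_iff.2 hu

/-- Asymptotic multiplicativity of `cosProd` under a perturbation which escapes to infinity. -/
theorem tendsto_cosProd_add_sub_mul {α : Type*} {l : Filter α} {u : ℤ → ℝ} {v : α → ℤ → ℝ}
    (hu : Summable u) (hv : ∀ n, Summable (v n)) {M : ℝ} (hM : ∀ n k, |v n k| ≤ M)
    (h0 : ∀ k, Tendsto (fun n => v n k) l (𝓝 0)) :
    Tendsto (fun n => cosProd (fun k => u k + v n k) - cosProd u * cosProd (v n)) l (𝓝 0) := by
  have h1 : Tendsto (fun n => ∑' k, |u k| * |v n k|) l (𝓝 (∑' _ : ℤ, 0)) := by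
    refine tendsto_tsum_of_dominated_convergence (hu.abs.mul_right M) (fun k => ?_)
      (Eventually.of_forall fun n k => ?_)
    · simpa using (h0 k).abs.const_mul |u k|
    · rw [norm_mul, norm_abs_eq_norm, norm_abs_eq_norm]
      exact mul_le_mul_of_nonneg_left (hM n k) (abs_nonneg _)
  rw [tsum_zero] at h1
  refine squeeze_zero_norm (fun n => abs_cosProd_add_sub_mul_le hu (hv n)) ?_
  simpa using h1.const_mul (Real.pi ^ 2)

theorem tendsto_cosProd_sub {α : Type*} {l : Filter α} {u v : α → ℤ → ℝ}
    (hu : ∀ n, Summable (u n)) (hv : ∀ n, Summable (v n))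
    (h : Tendsto (fun n => ∑' k, |u n k - v n k|) l (𝓝 0)) :
    Tendsto (fun n => cosProd (u n) - cosProd (v n)) l (𝓝 0) := by
  refine squeeze_zero_norm (fun n => abs_cosProd_sub_le (hu n) (hv n)) ?_
  simpa using h.const_mul Real.pi

/-- The restriction of a doubly infinite sequence to the nonnegative integers. -/
def truncate (u : ℤ → ℝ) (k : ℤ) : ℝ := if 0 ≤ k then u k else 0

theorem hasProd_cosProd_truncate {u : ℤ → ℝ} (hu : Summable fun k : ℕ => u k) :
    Summable (truncate u) ∧
      HasProd (fun k : ℕ => Real.cos (Real.pi * u k)) (cosProd (truncate u)) := by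
  have hcoe : ∀ k : ℕ, truncate u k = u k := fun k => by simp [truncate]
  have hout : ∀ k ∉ Set.range ((↑) : ℕ → ℤ), truncate u k = 0 := by
    intro k hk
    refine if_neg fun h => hk ?_
    exact ⟨k.toNat, Int.toNat_of_nonneg h⟩
  have hs : Summable (truncate u) := by
    rw [← Nat.cast_injective.summable_iff hout]
    simpa [Function.comp_def, hcoe] using hu
  refine ⟨hs, ?_⟩
  have h1 := (Nat.cast_injective (R := ℤ)).hasProd_iff
    (f := fun k => Real.cos (Real.pi * truncate u k)) (a := cosProd (truncate u))
    (fun k hk => by rw [hout k hk]; simp)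
  have := h1.2 (multipliable_cos hs).hasProd
  simpa [Function.comp_def, hcoe] using this

theorem summable_inv_pow_mul {θ : ℝ} (hθ : 1 < θ) (c : ℝ) :
    Summable fun k : ℕ => c * θ⁻¹ ^ ((k : ℤ).toNat) := by
  simpa using (summable_geometric_of_lt_one (by positivity)
    (inv_lt_one_of_one_lt₀ hθ)).mul_left c

/-- The Fourier coefficients of the Bernoulli convolution as doubly infinite cosine products. -/
theorem measureFourierCoeff_eq_cosProd {θ : ℝ} (hθ : 1 < θ) (n : ℤ) :
    measureFourierCoeff (circleBernoulli θ) n =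
      (cosProd (truncate fun k => 2 * n * θ⁻¹ ^ k.toNat) : ℂ) := by
  have h1 := (hasProd_cosProd_truncate (u := fun k : ℤ => 2 * n * θ⁻¹ ^ k.toNat)
    (summable_inv_pow_mul hθ (2 * n))).2.tendsto_prod_nat
  refine tendsto_nhds_unique (tendsto_prod_cos hθ n) ?_
  refine ((Complex.continuous_ofReal.tendsto _).comp h1).congr fun N => ?_
  simp only [Function.comp, Complex.ofReal_prod]
  refine Finset.prod_congr rfl fun k _ => ?_
  congr 2
  simp; ring

end CosProd

/-! ### Far translates are unaffected by truncation to the half line -/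

section TruncatedShift

/-- The error has two parts: the tail of `g` to the left of `-j n`, cut off by the truncation, and a
geometric series with vanishing coefficient `c n`. -/
theorem tendsto_tsum_abs_truncate_shift {α : Type*} {l : Filter α} {θ : ℝ} (hθ : 1 < θ)
    {g : ℤ → ℝ} (hg : Summable g) {j : α → ℤ} (hj : Tendsto j l atTop) {c : α → ℝ}
    (hc : Tendsto c l (𝓝 0)) :
    Tendsto (fun n => ∑' k, |truncate (fun k => g (k - j n) + c n * θ⁻¹ ^ k.toNat) k - g (k - j n)|)
      l (𝓝 0) := by
  set r : ℤ → ℝ := truncate fun k => 1 * θ⁻¹ ^ k.toNat with hr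
  have hrs : Summable r := (hasProd_cosProd_truncate (u := fun k : ℤ => 1 * θ⁻¹ ^ k.toNat)
    (summable_inv_pow_mul hθ 1)).1
  let s : α → ℤ → ℝ := fun n k => if k < -j n then |g k| else 0
  have hs : ∀ n, Summable (s n) := fun n =>
    hg.abs.of_nonneg_of_le (fun k => by simp only [s]; split_ifs <;> positivity)
      fun k => by simp only [s]; split_ifs <;> simp
  have hs0 : Tendsto (fun n => ∑' k, s n k) l (𝓝 0) := by
    have h1 : Tendsto (fun n => ∑' k, s n k) l (𝓝 (∑' _ : ℤ, 0)) := by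
      refine tendsto_tsum_of_dominated_convergence hg.abs (fun k => ?_)
        (Eventually.of_forall fun n k => ?_)
      · refine tendsto_const_nhds.congr' ?_
        filter_upwards [hj.eventually_ge_atTop (-k)] with n hn
        simp only [s]
        rw [if_neg (by linarith)]
      · simp only [s]; split_ifs <;> simp
    simpa using h1
  have hlim : Tendsto (fun n => ∑' k, s n k + |c n| * ∑' k, |r k|) l (𝓝 0) := by
    simpa using hs0.add (hc.abs.mul_const (∑' k, |r k|))
  refine squeeze_zero (fun n => tsum_nonneg fun k => abs_nonneg _) (fun n => ?_) hlim
  have hle : ∀ k, |truncate (fun k => g (k - j n) + c n * θ⁻¹ ^ k.toNat) k - g (k - j n)| ≤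
      s n (k - j n) + |c n| * |r k| := by
    intro k
    rcases le_or_gt 0 k with hk | hk
    · simp only [truncate, if_pos hk, s, hr, one_mul]
      rw [if_neg (by linarith), add_sub_cancel_left, abs_mul, zero_add]
    · simp only [truncate, if_neg (not_le.2 hk), s, hr]
      rw [if_pos (by linarith)]
      simp
  have hsh : Summable fun k => s n (k - j n) := summable_shift (hs n) _
  have hsum := hsh.add (hrs.abs.mul_left |c n|)
  refine ((hsum.of_nonneg_of_le (fun _ => abs_nonneg _) hle).tsum_le_tsum hle hsum).trans_eq ?_
  rw [hsh.tsum_add (hrs.abs.mul_left |c n|), tsum_mul_left]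
  congr 1
  exact (Equiv.subRight (j n)).tsum_eq (s n)

theorem summable_truncate_shift {θ : ℝ} (hθ : 1 < θ) {g : ℤ → ℝ} (hg : Summable g) (j : ℤ)
    (c : ℝ) : Summable (truncate fun k => g (k - j) + c * θ⁻¹ ^ k.toNat) := by
  refine (hasProd_cosProd_truncate ?_).1
  exact ((summable_shift hg j).comp_injective (Nat.cast_injective (R := ℤ))).add
    (summable_inv_pow_mul hθ c)

end TruncatedShift

/-! ### Conjugates and traces of a Pisot number -/

section Conjugates

open IntermediateField

theorem exists_embedding {θ : ℝ} (hθ : IsPisot θ) : ∃ σ₀ : ℚ⟮θ⟯ →ₐ[ℚ] ℂ,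
    σ₀ (AdjoinSimple.gen ℚ θ) = θ ∧ ∀ σ : ℚ⟮θ⟯ →ₐ[ℚ] ℂ, σ ≠ σ₀ →
      ‖σ (AdjoinSimple.gen ℚ θ)‖ < 1 := by
  have hθQ : IsIntegral ℚ θ := hθ.2.1.tower_top
  let σ₀ : ℚ⟮θ⟯ →ₐ[ℚ] ℂ := (Complex.ofRealAm.restrictScalars ℚ).comp (IntermediateField.val _)
  have hσ₀ : σ₀ (AdjoinSimple.gen ℚ θ) = θ := rfl
  refine ⟨σ₀, hσ₀, fun σ hσ => hθ.2.2 _ ?_ fun h => hσ ?_⟩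
  · rw [Polynomial.mem_aroots]
    refine ⟨minpoly.ne_zero hθQ, ?_⟩
    rw [← minpoly_gen ℚ θ, Polynomial.aeval_algHom_apply]
    exact (congrArg σ (minpoly.aeval ℚ (AdjoinSimple.gen ℚ θ))).trans (map_zero σ)
  · exact (adjoin.powerBasis hθQ).algHom_ext (h.trans hσ₀.symm)

/-- A rational power would be fixed by every embedding, but a second embedding exists and sends it
inside the unit disc. -/
theorem irrational_pow {θ : ℝ} (hθ : IsPisot θ) (hirr : Irrational θ) {k : ℕ} (hk : k ≠ 0) :
    Irrational (θ ^ k) := by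
  have hθQ : IsIntegral ℚ θ := hθ.2.1.tower_top
  obtain ⟨σ₀, hσ₀, hσ⟩ := exists_embedding hθ
  have : FiniteDimensional ℚ ℚ⟮θ⟯ := adjoin.finiteDimensional hθQ
  obtain ⟨σ, hne⟩ : ∃ σ : ℚ⟮θ⟯ →ₐ[ℚ] ℂ, σ ≠ σ₀ := by
    by_contra! hall
    have hcard : Fintype.card (ℚ⟮θ⟯ →ₐ[ℚ] ℂ) ≤ 1 :=
      Fintype.card_le_one_iff.2 fun a b => (hall a).trans (hall b).symm
    rw [AlgHom.card, adjoin.finrank hθQ] at hcard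
    have h1 := minpoly.natDegree_pos hθQ
    obtain ⟨q, hq⟩ := minpoly.natDegree_eq_one_iff.1 (le_antisymm hcard h1)
    exact hirr ⟨q, hq⟩
  rintro ⟨q, hq⟩
  have h1 : (AdjoinSimple.gen ℚ θ) ^ k = algebraMap ℚ ℚ⟮θ⟯ q := by
    apply (algebraMap ℚ⟮θ⟯ ℝ).injective
    rw [map_pow, AdjoinSimple.algebraMap_gen, ← hq, ← IsScalarTower.algebraMap_apply]
    rfl
  have h2 := congrArg σ h1
  have h3 := congrArg σ₀ h1
  rw [map_pow, AlgHom.commutes] at h2 h3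
  rw [hσ₀, ← h2] at h3
  have h4 := congrArg norm h3
  rw [norm_pow, norm_pow, Complex.norm_real, Real.norm_of_nonneg (by linarith [hθ.1])] at h4
  linarith [pow_lt_one₀ (norm_nonneg _) (hσ σ hne) hk, one_lt_pow₀ hθ.1 hk]

/-- The traces of the powers of a Pisot number are integers close to these powers. -/
theorem exists_int_seq_summable_sub_pow {θ : ℝ} (hθ : IsPisot θ) :
    ∃ T : ℕ → ℤ, Summable fun j => (T j : ℝ) - θ ^ j := by
  classical
  have hθQ : IsIntegral ℚ θ := hθ.2.1.tower_top
  obtain ⟨σ₀, hσ₀, hσ⟩ := exists_embedding hθ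
  have : FiniteDimensional ℚ ℚ⟮θ⟯ := adjoin.finiteDimensional hθQ
  have hgen : IsIntegral ℤ (AdjoinSimple.gen ℚ θ) := by
    rw [← isIntegral_algebraMap_iff (algebraMap ℚ⟮θ⟯ ℝ).injective, AdjoinSimple.algebraMap_gen]
    exact hθ.2.1
  have hT : ∀ j : ℕ, ∃ t : ℤ, algebraMap ℤ ℚ t =
      Algebra.trace ℚ ℚ⟮θ⟯ (AdjoinSimple.gen ℚ θ ^ j) := fun j =>
    IsIntegrallyClosed.isIntegral_iff.1 (Algebra.isIntegral_trace (hgen.pow j))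
  choose T hT using hT
  refine ⟨T, ?_⟩
  have hsum : ∀ j, (((T j : ℝ) - θ ^ j : ℝ) : ℂ) =
      ∑ σ ∈ Finset.univ.erase σ₀, σ (AdjoinSimple.gen ℚ θ) ^ j := by
    intro j
    have h1 := trace_eq_sum_embeddings (K := ℚ) (L := ℚ⟮θ⟯) ℂ (x := AdjoinSimple.gen ℚ θ ^ j)
    rw [← hT j, ← Finset.add_sum_erase _ _ (Finset.mem_univ σ₀)] at h1
    simp only [map_pow, hσ₀] at h1
    push_cast
    rw [sub_eq_iff_eq_add', ← h1]
    simp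
  rw [← Complex.summable_ofReal]
  simp only [hsum]
  exact summable_sum fun σ hs => summable_geometric_of_norm_lt_one (hσ σ (Finset.ne_of_mem_erase hs))

end Conjugates

/-! ### Limit points, and why there are infinitely many -/

section LimitPoints

theorem mem_limitPoints_iff {a : ℤ → ℂ} {z : ℂ} : z ∈ limitPoints a ↔ MapClusterPt z cofinite a := by
  simp only [mapClusterPt_iff_frequently, frequently_cofinite_iff_infinite]
  rfl

theorem isClosed_limitPoints (a : ℤ → ℂ) : IsClosed (limitPoints a) := by
  have : limitPoints a = {z | ClusterPt z (map a cofinite)} := Set.ext fun z => mem_limitPoints_iff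
  rw [this]
  exact isClosed_setOfPred_clusterPt

theorem mem_limitPoints_of_tendsto {a : ℤ → ℂ} {z : ℂ} {n : ℕ → ℤ} (hn : Tendsto n atTop cofinite)
    (h : Tendsto (fun j => a (n j)) atTop (𝓝 z)) : z ∈ limitPoints a :=
  mem_limitPoints_iff.2 (MapClusterPt.of_comp hn (Tendsto.mapClusterPt h))

theorem limitPoints_subset_closure (a : ℤ → ℂ) : limitPoints a ⊆ closure (Set.range a) := by
  intro z hz
  rw [mem_closure_iff_nhds]
  intro U hU
  obtain ⟨n, hn⟩ := (hz U hU).nonempty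
  exact ⟨a n, hn, n, rfl⟩

theorem closure_range_subset (a : ℤ → ℂ) : closure (Set.range a) ⊆ Set.range a ∪ limitPoints a := by
  intro z hz
  by_contra hcon
  have h1 : ¬ ∀ U ∈ 𝓝 z, {n : ℤ | a n ∈ U}.Infinite := fun h => hcon (Or.inr h)
  push Not at h1
  obtain ⟨U, hU, hfin⟩ := h1
  have hV : U ∩ (a '' {n : ℤ | a n ∈ U})ᶜ ∈ 𝓝 z := by
    refine inter_mem hU ((hfin.image a).isClosed.isOpen_compl.mem_nhds ?_)
    rintro ⟨n, -, hn⟩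
    exact hcon (Or.inl ⟨n, hn⟩)
  obtain ⟨_, ⟨hx1, hx2⟩, n, rfl⟩ := mem_closure_iff_nhds.1 hz _ hV
  exact hx2 ⟨n, hx1, rfl⟩

theorem limitPoints_infinite {θ : ℝ} (hθ : IsPisot θ) (hirr : Irrational θ) :
    (limitPoints (measureFourierCoeff (circleBernoulli θ))).Infinite := by
  have h1θ := hθ.1
  have h0θ : 0 < θ := by linarith
  obtain ⟨T, hT⟩ := exists_int_seq_summable_sub_pow hθ
  set η : ℕ → ℝ := fun j => (T j : ℝ) - θ ^ j with hη
  -- A representative of `2 * θ ^ (-l)` modulo `2` that is summable in both directions: for `l ≤ 0`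
  -- the even integer `2 * T (-l)` has been subtracted.
  let g : ℤ → ℝ := fun l => if 0 < l then 2 * θ⁻¹ ^ l.toNat else -2 * η (-l).toNat
  have hgpos : ∀ l : ℤ, 0 < l → g l = 2 * θ⁻¹ ^ l.toNat := fun l hl => if_pos hl
  have hgneg : ∀ l : ℤ, ¬ 0 < l → g l = -2 * η (-l).toNat := fun l hl => if_neg hl
  have hg : Summable g := by
    refine Summable.of_nat_of_neg ?_ ?_
    · refine (summable_nat_add_iff 1).1 ?_
      refine ((summable_nat_add_iff 1).2 (summable_inv_pow_mul h1θ 2)).congr fun k => ?_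
      rw [hgpos _ (by positivity)]
    · refine (hT.mul_left (-2)).congr fun k => ?_
      rw [hgneg _ (by simp)]
      simp [hη]
  have hcos : ∀ l : ℤ, Real.cos (Real.pi * g l) = Real.cos (2 * Real.pi * θ ^ (-l)) := by
    intro l
    by_cases hl : 0 < l
    · rw [hgpos l hl]
      lift l to ℕ using hl.le
      simp
      ring_nf
    · rw [hgneg l hl]
      obtain ⟨k, rfl⟩ : ∃ k : ℕ, l = -k := ⟨(-l).toNat, by omega⟩
      simp only [hη, neg_neg, Int.toNat_natCast, zpow_natCast]
      rw [show Real.pi * (-2 * ((T k : ℝ) - θ ^ k)) = 2 * Real.pi * θ ^ k - T k * (2 * Real.pi) by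
        ring, Real.cos_sub_int_mul_two_pi]
  set Φ := cosProd g with hΦ
  have hΦ0 : Φ ≠ 0 := by
    refine cosProd_ne_zero hg fun l => ?_
    rw [hcos]
    intro h
    obtain ⟨k, hk⟩ := Real.cos_eq_zero_iff.1 h
    have h2 : θ ^ (-l) = (2 * k + 1) / 4 := by
      field_simp at hk
      linarith
    have hrat : ¬ Irrational (θ ^ (-l)) := by
      rw [h2]
      exact fun hi => hi ⟨(2 * k + 1) / 4, by push_cast; ring⟩
    rcases lt_trichotomy l 0 with hl | rfl | hl
    · obtain ⟨n, rfl⟩ : ∃ n : ℕ, l = -n := ⟨(-l).toNat, by omega⟩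
      rw [neg_neg, zpow_natCast] at hrat
      exact hrat (irrational_pow hθ hirr (by rintro rfl; simp at hl))
    · rw [neg_zero, zpow_zero, eq_div_iff four_ne_zero, one_mul] at h2
      have h3 : (4 : ℤ) = 2 * k + 1 := by exact_mod_cast h2
      omega
    · lift l to ℕ using hl.le
      rw [zpow_neg, zpow_natCast] at hrat
      exact hrat (irrational_pow hθ hirr (by rintro rfl; simp at hl)).inv
  -- The single factor `cos (2πθ)` suffices: modulus `1` would make `2θ` an integer.
  have hΦ1 : |Φ| < 1 := by
    refine (abs_cosProd_le_abs_prod hg {-1}).trans_lt ?_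
    rw [Finset.prod_singleton, hcos]
    refine lt_of_le_of_ne (Real.abs_cos_le_one _) fun h => ?_
    rw [Real.abs_cos_eq_one_iff] at h
    obtain ⟨k, hk⟩ := h
    refine hirr ⟨k / 2, ?_⟩
    have := Real.pi_pos
    simp at hk
    push_cast
    rw [div_eq_iff two_ne_zero]
    refine mul_left_cancel₀ Real.pi_ne_zero ?_
    linarith
  have hη0 : Tendsto η atTop (𝓝 0) := hT.tendsto_atTop_zero
  have hTtop : Tendsto T atTop atTop := by
    rw [← tendsto_intCast_atTop_iff (R := ℝ)]
    have := hη0.add_atTop (tendsto_pow_atTop_atTop_of_one_lt h1θ)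
    simpa [hη] using this
  have hlim : ∀ m : ℤ, Tendsto (fun j => measureFourierCoeff (circleBernoulli θ) (m + T j)) atTop
      (𝓝 (measureFourierCoeff (circleBernoulli θ) m * Φ)) := by
    intro m
    simp only [measureFourierCoeff_eq_cosProd h1θ]
    rw [← Complex.ofReal_mul]
    refine (Complex.continuous_ofReal.tendsto _).comp ?_
    set u : ℤ → ℝ := truncate fun k => 2 * m * θ⁻¹ ^ k.toNat with hu
    have hus : Summable u := (hasProd_cosProd_truncate (u := fun k : ℤ => 2 * m * θ⁻¹ ^ k.toNat)
      (summable_inv_pow_mul h1θ (2 * m))).1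
    -- On `k ≥ 0` this is `2 * T j * θ⁻¹ ^ k` modulo `2`: write `T j = θ ^ j + η j` and reduce `2 *
    -- θ ^ (j - k)` to `g (k - j)`.
    let w : ℕ → ℤ → ℝ := fun j => truncate fun k => g (k - (j : ℤ)) + 2 * η j * θ⁻¹ ^ k.toNat
    have hw : ∀ j, Summable (w j) := fun j => summable_truncate_shift h1θ hg _ _
    have hτ : ∀ j : ℕ, Summable fun k => g (k - (j : ℤ)) := fun j => summable_shift hg _
    have e1 : ∀ j, cosProd (truncate fun k => 2 * ((m + T j : ℤ) : ℝ) * θ⁻¹ ^ k.toNat) =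
        cosProd (fun k => u k + w j k) := by
      intro j
      refine tprod_congr fun k => ?_
      simp only [truncate, hu, w]
      split_ifs with hk
      · lift k to ℕ using hk
        simp only [Int.toNat_natCast]
        push_cast
        have hTj : (T j : ℝ) = η j + θ ^ j := by simp [hη]
        by_cases hkj : k ≤ j
        · obtain ⟨i, rfl⟩ := Nat.exists_eq_add_of_le hkj
          have hx : θ ^ (k + i) * θ⁻¹ ^ k = θ ^ i := by
            rw [pow_add, inv_pow]; field_simp
          rw [hgneg _ (by push_cast; omega),
            show (-((k : ℤ) - ((k + i : ℕ) : ℤ))).toNat = i by push_cast; omega,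
            ← Real.cos_sub_int_mul_two_pi _ (T i), hTj]
          congr 1
          simp only [hη]
          linear_combination 2 * Real.pi * hx
        · obtain ⟨i, rfl⟩ := Nat.exists_eq_add_of_lt (not_le.1 hkj)
          have hx : θ ^ j * θ⁻¹ ^ (j + i + 1) = θ⁻¹ ^ (i + 1) := by
            rw [add_assoc, pow_add, inv_pow, inv_pow]; field_simp
          rw [hgpos _ (by push_cast; omega),
            show (((j + i + 1 : ℕ) : ℤ) - (j : ℤ)).toNat = i + 1 by push_cast; omega, hTj]
          congr 1
          linear_combination 2 * Real.pi * hx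
      · simp
    have l1 : Tendsto (fun j => cosProd (fun k => u k + w j k) -
        cosProd (fun k => u k + g (k - (j : ℤ)))) atTop (𝓝 0) := by
      refine tendsto_cosProd_sub (fun j => hus.add (hw j)) (fun j => hus.add (hτ j)) ?_
      simp only [add_sub_add_left_eq_sub]
      refine tendsto_tsum_abs_truncate_shift h1θ hg tendsto_natCast_atTop_atTop ?_
      simpa using hη0.const_mul 2
    have l2 : Tendsto (fun j : ℕ => cosProd (fun k => u k + g (k - (j : ℤ))) -
        cosProd u * cosProd (fun k => g (k - (j : ℤ)))) atTop (𝓝 0) := by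
      refine tendsto_cosProd_add_sub_mul (M := ∑' k, |g k|) hus hτ
        (fun j k => hg.abs.le_tsum (k - (j : ℤ)) fun _ _ => abs_nonneg _) fun k => ?_
      refine hg.tendsto_cofinite_zero.comp (Function.Injective.tendsto_cofinite ?_ |>.mono_left
        Nat.cofinite_eq_atTop.ge)
      intro a b hab
      simpa using hab
    have l3 := (l1.add l2).add_const (cosProd u * Φ)
    rw [add_zero, zero_add] at l3
    refine l3.congr fun j => ?_
    simp only [e1, cosProd_shift, hΦ]
    ring
  set a := measureFourierCoeff (circleBernoulli θ) with ha
  have hrange : ∀ m, a m * Φ ∈ limitPoints a := by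
    intro m
    refine mem_limitPoints_of_tendsto (n := fun j => m + T j) ?_ (hlim m)
    exact (tendsto_atTop_add_const_left _ m hTtop).mono_right atTop_le_cofinite
  -- Limit points form a closed set inside this closure, so multiplication by `Φ` can be iterated.
  have hclosure : ∀ z ∈ closure (Set.range a), z * Φ ∈ limitPoints a := by
    intro z hz
    have hc : Continuous fun z : ℂ => z * Φ := by fun_prop
    have := hc.closure_preimage_subset (limitPoints a)
    rw [(isClosed_limitPoints a).closure_eq] at this
    refine this (closure_mono ?_ hz)
    rintro _ ⟨m, rfl⟩
    exact hrange m
  have hpow : ∀ r : ℕ, ((Φ ^ (r + 1) : ℝ) : ℂ) ∈ limitPoints a := by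
    intro r
    induction r with
    | zero =>
      have h0 := hrange 0
      have : a 0 = 1 := by
        rw [ha, measureFourierCoeff]; simp
      simpa [this] using h0
    | succ r ih =>
      have := hclosure _ (limitPoints_subset_closure a ih)
      rwa [← Complex.ofReal_mul, ← pow_succ] at this
  refine Set.infinite_of_injective_forall_mem (f := fun r : ℕ => ((Φ ^ (r + 1) : ℝ) : ℂ)) ?_ hpow
  intro r s hrs
  have h1 : Φ ^ (r + 1) = Φ ^ (s + 1) := Complex.ofReal_injective hrs
  have h2 := congrArg abs h1
  rw [abs_pow, abs_pow] at h2
  have := pow_right_injective₀ (abs_pos.2 hΦ0) hΦ1.ne h2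
  omega

end LimitPoints

/-! ### Linear recurrences without characteristic roots on the unit circle -/

section Recurrence

open Polynomial

/-- The shift `(S f) k = f (k - 1)` on doubly infinite sequences. -/
def shift : Module.End ℂ (ℤ → ℂ) := LinearMap.funLeft ℂ ℂ fun k => k - 1

theorem shift_apply (f : ℤ → ℂ) (k : ℤ) : shift f k = f (k - 1) := rfl

theorem shift_pow_apply (i : ℕ) (f : ℤ → ℂ) (k : ℤ) : (shift ^ i) f k = f (k - i) := by
  induction i generalizing k with
  | zero => simp
  | succ i ih =>
    rw [pow_succ', Module.End.mul_apply, shift_apply, ih]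
    congr 1; push_cast; ring

theorem aeval_shift_apply (P : ℂ[X]) (f : ℤ → ℂ) (k : ℤ) :
    aeval shift P f k = ∑ i ∈ Finset.range (P.natDegree + 1), P.coeff i * f (k - i) := by
  rw [aeval_eq_sum_range, LinearMap.sum_apply, Finset.sum_apply]
  refine Finset.sum_congr rfl fun i _ => ?_
  rw [LinearMap.smul_apply, Pi.smul_apply, shift_pow_apply, smul_eq_mul]

theorem aeval_shift_X_sub_C_apply (α : ℂ) (f : ℤ → ℂ) (k : ℤ) :
    aeval shift (X - C α) f k = f (k - 1) - α * f k := by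
  simp [shift_apply, Algebra.algebraMap_eq_smul_one]

/-- A geometric series of translates of a summable sequence is summable. -/
theorem exists_summable_eq_add_mul {β : ℂ} (hβ : ‖β‖ < 1) {g : ℤ → ℂ} (hg : Summable g) (t : ℤ) :
    ∃ h : ℤ → ℂ, Summable h ∧ ∀ k, h k = g k + β * h (k + t) := by
  have h1 : Summable fun z : ℤ × ℕ => g z.1 * β ^ z.2 :=
    summable_mul_of_summable_norm hg.norm (summable_norm_geometric_of_norm_lt_one hβ)
  let e : ℤ × ℕ ≃ ℤ × ℕ :=
    { toFun := fun z => (z.1 + z.2 * t, z.2)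
      invFun := fun z => (z.1 - z.2 * t, z.2)
      left_inv := fun z => by simp
      right_inv := fun z => by simp }
  have h2 : Summable fun z : ℤ × ℕ => g (z.1 + z.2 * t) * β ^ z.2 := e.summable_iff.2 h1
  refine ⟨fun k => ∑' j : ℕ, g (k + j * t) * β ^ j, h2.prod, fun k => ?_⟩
  have h3 : Summable fun j : ℕ => g (k + j * t) * β ^ j := h2.prod_factor k
  beta_reduce
  rw [h3.tsum_eq_zero_add, ← tsum_mul_left]
  congr 1
  · simp
  · refine tsum_congr fun j => ?_
    rw [pow_succ', show k + ((j + 1 : ℕ) : ℤ) * t = k + t + j * t by push_cast; ring]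
    ring

/-- The inverse of `shift - α` is a geometric series: in powers of `α` and forward translates if
`‖α‖ < 1`, in powers of `α⁻¹` and backward translates if `‖α‖ > 1`. -/
theorem exists_summable_shift_sub {α : ℂ} (hα : ‖α‖ ≠ 1) {g : ℤ → ℂ} (hg : Summable g) :
    ∃ h : ℤ → ℂ, Summable h ∧ aeval shift (X - C α) h = g := by
  rcases hα.lt_or_gt with hα | hα
  · obtain ⟨h, hs, hh⟩ := exists_summable_eq_add_mul hα hg 1
    refine ⟨fun k => h (k + 1), (Equiv.addRight (1 : ℤ)).summable_iff.2 hs, funext fun k => ?_⟩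
    rw [aeval_shift_X_sub_C_apply, sub_add_cancel, hh k]
    ring
  · have hα0 : α ≠ 0 := by rintro rfl; simp at hα; linarith
    obtain ⟨h, hs, hh⟩ := exists_summable_eq_add_mul (β := α⁻¹)
      (by rw [norm_inv]; exact inv_lt_one_of_one_lt₀ hα) hg (-1)
    refine ⟨fun k => -α⁻¹ * h k, hs.mul_left _, funext fun k => ?_⟩
    rw [aeval_shift_X_sub_C_apply, sub_eq_add_neg k 1, hh k]
    field_simp
    ring

/-- A polynomial without roots on the unit circle has a summable fundamental solution. -/
theorem exists_fundamental_solution (s : Multiset ℂ) (hs : ∀ α ∈ s, ‖α‖ ≠ 1) :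
    ∃ G : ℤ → ℂ, Summable G ∧
      aeval shift (s.map fun α => X - C α).prod G = Pi.single 0 1 := by
  induction s using Multiset.induction_on with
  | empty =>
    refine ⟨Pi.single 0 1, ?_, by simp⟩
    exact summable_of_ne_finset_zero (s := {0}) fun k hk => by
      rw [Pi.single_eq_of_ne (by simpa using hk)]
  | cons α s ih =>
    obtain ⟨G, hG, hGs⟩ := ih fun β hβ => hs β (Multiset.mem_cons_of_mem hβ)
    obtain ⟨h, hh, hhs⟩ := exists_summable_shift_sub (hs α (Multiset.mem_cons_self α s)) hG
    refine ⟨h, hh, ?_⟩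
    rw [Multiset.map_cons, Multiset.prod_cons, mul_comm, map_mul, Module.End.mul_apply, hhs, hGs]

/-- A solution, bounded towards `+∞`, of a recurrence with all roots inside the unit disc
vanishes. -/
theorem eq_zero_of_aeval_shift_eq_zero (s : Multiset ℂ) (hs : ∀ α ∈ s, ‖α‖ < 1) {w : ℤ → ℂ}
    {N : ℤ} {M : ℝ} (hM : ∀ k, N ≤ k → ‖w k‖ ≤ M)
    (hw : ∀ k, N + s.card ≤ k → aeval shift (s.map fun α => X - C α).prod w k = 0) :
    ∀ k, N ≤ k → w k = 0 := by
  induction s using Multiset.induction_on generalizing w N M with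
  | empty => simpa using hw
  | cons α s ih =>
    have hα := hs α (Multiset.mem_cons_self α s)
    have h1 : ∀ k, N + 1 ≤ k → aeval shift (X - C α) w k = 0 := by
      refine ih (fun β hβ => hs β (Multiset.mem_cons_of_mem hβ)) (M := M + ‖α‖ * M)
        (fun k hk => ?_) fun k hk => ?_
      · rw [aeval_shift_X_sub_C_apply]
        refine (norm_sub_le _ _).trans ?_
        rw [norm_mul]
        gcongr
        · exact hM _ (by omega)
        · exact hM _ (by omega)
      · have := hw k (by rw [Multiset.card_cons]; push_cast; omega)
        rwa [Multiset.map_cons, Multiset.prod_cons, mul_comm, map_mul,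
          Module.End.mul_apply] at this
    have h2 : ∀ k, N ≤ k → w k = α * w (k + 1) := by
      intro k hk
      have := h1 (k + 1) (by omega)
      rwa [aeval_shift_X_sub_C_apply, add_sub_cancel_right, sub_eq_zero] at this
    -- The solutions for the root `α` are multiples of `α ^ (-k)`, which grow towards `+∞`;
    -- boundedness therefore forces zero.
    have h3 : ∀ j : ℕ, ∀ k, N ≤ k → w k = α ^ j * w (k + j) := by
      intro j
      induction j with
      | zero => simp
      | succ j ihj =>
        intro k hk
        rw [ihj k hk, h2 (k + j) (by omega), pow_succ, mul_assoc]
        push_cast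
        ring_nf
    intro k hk
    have h4 : ∀ j : ℕ, ‖w k‖ ≤ ‖α‖ ^ j * M := by
      intro j
      rw [h3 j k hk, norm_mul, norm_pow]
      gcongr
      exact hM _ (by omega)
    have h5 : Tendsto (fun j : ℕ => ‖α‖ ^ j * M) atTop (𝓝 0) := by
      simpa using (tendsto_pow_atTop_nhds_zero_of_lt_one (norm_nonneg α) hα).mul_const M
    exact norm_le_zero_iff.1 (ge_of_tendsto' h5 h4)

variable {θ : ℝ}

/-- The linear recurrence operator given by the minimal polynomial over `ℤ`. -/
def recur (θ : ℝ) (f : ℤ → ℝ) (k : ℤ) : ℝ :=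
  ∑ i ∈ Finset.range ((minpoly ℤ θ).natDegree + 1), ((minpoly ℤ θ).coeff i : ℝ) * f (k - i)

/-- By separability `θ` is a simple root, so the roots left after removing it once are true other
conjugates. -/
theorem exists_roots (hθ : IsPisot θ) : ∃ s : Multiset ℂ, (∀ α ∈ s, ‖α‖ < 1) ∧
    (minpoly ℤ θ).map (algebraMap ℤ ℂ) = ((θ : ℂ) ::ₘ s |>.map fun α => X - C α).prod := by
  have hθQ : IsIntegral ℚ θ := hθ.2.1.tower_top
  have hmap : (minpoly ℤ θ).map (algebraMap ℤ ℂ) = (minpoly ℚ θ).map (algebraMap ℚ ℂ) := by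
    rw [minpoly.isIntegrallyClosed_eq_field_fractions' ℚ hθ.2.1, Polynomial.map_map]
    rfl
  have hmonic := (minpoly.monic hθQ).map (algebraMap ℚ ℂ)
  have hnodup : ((minpoly ℚ θ).aroots ℂ).Nodup :=
    nodup_roots (minpoly.irreducible hθQ).separable.map
  have hmem : (θ : ℂ) ∈ (minpoly ℚ θ).aroots ℂ := by
    rw [mem_aroots]
    refine ⟨minpoly.ne_zero hθQ, ?_⟩
    have := aeval_algHom_apply (Complex.ofRealAm.restrictScalars ℚ) θ (minpoly ℚ θ)
    rw [minpoly.aeval, map_zero] at this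
    exact this
  refine ⟨((minpoly ℚ θ).aroots ℂ).erase θ, fun α hα => ?_, ?_⟩
  · exact hθ.2.2 α (Multiset.mem_of_mem_erase hα) (hnodup.mem_erase_iff.1 hα).1
  · rw [Multiset.cons_erase hmem, hmap]
    exact (IsAlgClosed.splits _).eq_prod_roots_of_monic hmonic

theorem ofReal_recur (f : ℤ → ℝ) (k : ℤ) (hθ : IsPisot θ) :
    ((recur θ f k : ℝ) : ℂ) =
      aeval shift ((minpoly ℤ θ).map (algebraMap ℤ ℂ)) (fun k => (f k : ℂ)) k := by
  rw [aeval_shift_apply, (minpoly.monic hθ.2.1).natDegree_map, recur]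
  simp

theorem exists_green (hθ : IsPisot θ) : ∃ G : ℤ → ℝ, Summable G ∧
    ∀ k, recur θ G k = if k = 0 then 1 else 0 := by
  obtain ⟨s, hs, hp⟩ := exists_roots hθ
  obtain ⟨G, hG, hGs⟩ := exists_fundamental_solution ((θ : ℂ) ::ₘ s) (by
    intro α hα
    rcases Multiset.mem_cons.1 hα with rfl | hα
    · rw [Complex.norm_real, Real.norm_of_nonneg (by linarith [hθ.1])]
      exact hθ.1.ne'
    · exact (hs α hα).ne)
  rw [← hp] at hGs
  refine ⟨fun k => (G k).re, (Complex.hasSum_re hG.hasSum).summable, fun k => ?_⟩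
  have h1 := congrArg Complex.re (congrFun hGs k)
  rw [aeval_shift_apply, (minpoly.monic hθ.2.1).natDegree_map, Complex.re_sum,
    Pi.single_apply] at h1
  rw [recur]
  refine Eq.trans (Finset.sum_congr rfl fun i _ => ?_) (h1.trans (by split_ifs <;> simp))
  simp [Complex.mul_re]

/-- Applying the factor of `θ` leaves a bounded sequence killed by the factors with roots inside the
disc, hence zero; so `h (k - 1) = θ * h k` for `k ≥ 1`. -/
theorem eq_mul_inv_pow_of_recur_eq_zero (hθ : IsPisot θ) {h : ℤ → ℝ} {M : ℝ}
    (hM : ∀ k, 0 ≤ k → |h k| ≤ M) (hh : ∀ k : ℤ, (minpoly ℤ θ).natDegree ≤ k → recur θ h k = 0) :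
    ∀ k : ℕ, h k = h 0 * θ⁻¹ ^ k := by
  obtain ⟨s, hs, hp⟩ := exists_roots hθ
  have hdeg : (minpoly ℤ θ).natDegree = s.card + 1 := by
    rw [← (minpoly.monic hθ.2.1).natDegree_map (algebraMap ℤ ℂ), hp,
      natDegree_multiset_prod_X_sub_C_eq_card, Multiset.card_cons]
  have h0 : 0 < θ := by linarith [hθ.1]
  have h1 := eq_zero_of_aeval_shift_eq_zero s hs (N := 1) (M := M + ‖(θ : ℂ)‖ * M)
    (w := aeval shift (X - C (θ : ℂ)) fun k => (h k : ℂ)) (fun k hk => by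
      rw [aeval_shift_X_sub_C_apply]
      refine (norm_sub_le _ _).trans ?_
      rw [norm_mul, Complex.norm_real, Complex.norm_real (h k)]
      gcongr
      · exact hM _ (by omega)
      · exact hM _ (by omega)) (fun k hk => by
      have := hh k (by rw [hdeg]; push_cast; omega)
      rw [← Complex.ofReal_eq_zero, ofReal_recur _ _ hθ, hp] at this
      rwa [Multiset.map_cons, Multiset.prod_cons, mul_comm, map_mul,
          Module.End.mul_apply] at this)
  intro k
  induction k with
  | zero => simp
  | succ k ih =>
    have h2 := h1 (k + 1) (by omega)
    rw [aeval_shift_X_sub_C_apply, add_sub_cancel_right, ih] at h2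
    have h3 : h 0 * θ⁻¹ ^ k - θ * h (k + 1) = 0 := by exact_mod_cast h2
    push_cast
    rw [pow_succ]
    field_simp
    field_simp at h3
    linarith

end Recurrence

/-! ### Large coefficients come from boundedly many integer impulses -/

section Decomposition

variable {θ : ℝ}

/-- The response on the half line to a unit impulse at `j`, normalized to vanish at `0`. -/
def halfLineGreen (θ : ℝ) (G : ℤ → ℝ) (j : ℤ) : ℤ → ℝ :=
  truncate fun k => G (k - j) + -G (-j) * θ⁻¹ ^ k.toNat

theorem summable_halfLineGreen (hθ : 1 < θ) {G : ℤ → ℝ} (hG : Summable G) (j : ℤ) :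
    Summable (halfLineGreen θ G j) := summable_truncate_shift hθ hG _ _

theorem abs_cosProd_congr {u v : ℤ → ℝ} (hu : Summable u) (hv : Summable v)
    (h : ∀ k, |Real.cos (Real.pi * u k)| = |Real.cos (Real.pi * v k)|) :
    |cosProd u| = |cosProd v| := by
  unfold cosProd
  rw [← Real.norm_eq_abs, ← Real.norm_eq_abs, (multipliable_cos hu).norm_tprod,
    (multipliable_cos hv).norm_tprod]
  exact tprod_congr h

theorem abs_cos_pi_mul_sub_int (x : ℝ) (n : ℤ) :
    |Real.cos (Real.pi * (x - n))| = |Real.cos (Real.pi * x)| := by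
  rw [mul_sub, mul_comm Real.pi (n : ℝ), Real.cos_sub_int_mul_pi, abs_mul, abs_zpow]
  simp

/-- Padding with zero coefficients gives an index type `Fin m` independent of `F`, so that later the
data for different `n` can be compared along an ultrafilter. -/
theorem exists_fin_enumeration (b : ℤ → ℤ) {B : ℕ} (hB : ∀ k, |b k| ≤ B) (m : ℕ) :
    ∀ F : Finset ℤ, (∀ k ∈ F, 0 ≤ k) → F.card ≤ m → ∃ c j : Fin m → ℤ, (∀ i, |c i| ≤ B) ∧
      (∀ i, 0 ≤ j i) ∧ ∀ f : ℤ → ℝ, ∑ x ∈ F, b x * f x = ∑ i, c i * f (j i) := by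
  classical
  induction m with
  | zero =>
    intro F _ hF
    rw [Finset.card_eq_zero.1 (Nat.le_zero.1 hF)]
    exact ⟨0, 0, by simp, by simp, by simp⟩
  | succ m ih =>
    intro F hF0 hF
    rcases F.eq_empty_or_nonempty with rfl | ⟨a, ha⟩
    · exact ⟨0, 0, by simp, by simp, by simp⟩
    · obtain ⟨c, j, hc, hj, hs⟩ := ih (F.erase a) (fun k hk => hF0 k (Finset.mem_of_mem_erase hk))
        (by rw [Finset.card_erase_of_mem ha]; omega)
      refine ⟨Fin.cons (b a) c, Fin.cons a j, Fin.cases (hB a) hc, Fin.cases (hF0 a ha) hj,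
        fun f => ?_⟩
      rw [Fin.sum_univ_succ, ← Finset.add_sum_erase _ _ ha, hs]
      simp

theorem recur_zpow (hθ : IsPisot θ) (c : ℝ) (k : ℤ) : recur θ (fun k => c * θ ^ (-k)) k = 0 := by
  have h0 : θ ≠ 0 := by linarith [hθ.1]
  have h1 := minpoly.aeval ℤ θ
  rw [Polynomial.aeval_eq_sum_range] at h1
  have : recur θ (fun k => c * θ ^ (-k)) k = c * θ ^ (-k) * ∑ i ∈ Finset.range
      ((minpoly ℤ θ).natDegree + 1), (minpoly ℤ θ).coeff i • θ ^ i := by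
    rw [recur, Finset.mul_sum]
    refine Finset.sum_congr rfl fun i _ => ?_
    rw [neg_sub, sub_eq_add_neg, zpow_add₀ h0, zpow_natCast, zsmul_eq_mul]
    ring
  rw [this, h1, mul_zero]

theorem recur_sub (f g : ℤ → ℝ) (k : ℤ) :
    recur θ (fun k => f k - g k) k = recur θ f k - recur θ g k := by
  simp only [recur, mul_sub, Finset.sum_sub_distrib]

theorem recur_sum {G : ℤ → ℝ} (hG : ∀ k, recur θ G k = if k = 0 then 1 else 0) (b : ℤ → ℤ)
    (F : Finset ℤ) (k : ℤ) : recur θ (fun k => ∑ j ∈ F, b j * G (k - j)) k =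
      if k ∈ F then (b k : ℝ) else 0 := by
  have h1 : recur θ (fun k => ∑ j ∈ F, b j * G (k - j)) k = ∑ j ∈ F, b j * recur θ G (k - j) := by
    simp only [recur, Finset.mul_sum]
    rw [Finset.sum_comm]
    refine Finset.sum_congr rfl fun j _ => Finset.sum_congr rfl fun i _ => ?_
    rw [sub_right_comm]
    ring
  rw [h1]
  simp only [hG, sub_eq_zero, mul_ite, mul_one, mul_zero, Finset.sum_ite_eq]

theorem abs_recur_le {f : ℤ → ℝ} {k : ℤ} {ε : ℝ}
    (h : ∀ i ≤ (minpoly ℤ θ).natDegree, |f (k - i)| ≤ ε) :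
    |recur θ f k| ≤ (∑ i ∈ Finset.range ((minpoly ℤ θ).natDegree + 1),
      |((minpoly ℤ θ).coeff i : ℝ)|) * ε := by
  rw [recur, Finset.sum_mul]
  refine (Finset.abs_sum_le_sum_abs _ _).trans (Finset.sum_le_sum fun i hi => ?_)
  rw [abs_mul]
  exact mul_le_mul_of_nonneg_left (h i (by rw [Finset.mem_range] at hi; omega)) (abs_nonneg _)

/-- A lower bound for a cosine product bounds the number of indices at which the sequence is not
close to an integer. -/
theorem exists_card_le {ε δ : ℝ} (hε : 0 < ε) (hδ : 0 < δ) :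
    ∃ M : ℕ, ∀ u : ℤ → ℝ, Summable u → δ ≤ |cosProd u| →
      ∀ t : Finset ℤ, (∀ k ∈ t, ε ≤ |u k - round (u k)|) → t.card ≤ M := by
  rcases le_or_gt ε (1 / 2) with hε2 | hε2
  · set q := Real.cos (Real.pi * ε) with hq
    have hπ := Real.pi_pos
    have hq0 : 0 ≤ q := Real.cos_nonneg_of_neg_pi_div_two_le_of_le (by nlinarith) (by nlinarith)
    have hq1 : q < 1 := by
      rw [hq, ← Real.cos_zero]
      exact Real.cos_lt_cos_of_nonneg_of_le_pi le_rfl (by nlinarith) (by positivity)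
    obtain ⟨M, hM⟩ := exists_pow_lt_of_lt_one hδ hq1
    refine ⟨M, fun u hu hδu t ht => ?_⟩
    by_contra! hcon
    -- Each index of `t` contributes a factor of modulus at most `q = cos (π ε) < 1`.
    have h1 : |cosProd u| ≤ q ^ t.card := by
      refine (abs_cosProd_le_abs_prod hu t).trans ?_
      rw [← Finset.prod_const]
      refine Finset.prod_le_prod (fun _ _ => abs_nonneg _) fun k hk => ?_
      have h2 := ht k hk
      have h3 := abs_sub_round (u k)
      rw [← abs_cos_pi_mul_sub_int (u k) (round (u k)), ← Real.cos_abs, abs_mul, abs_of_pos hπ,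
        abs_of_nonneg (Real.cos_nonneg_of_neg_pi_div_two_le_of_le (by nlinarith [abs_nonneg (u k -
          round (u k))]) (by nlinarith))]
      exact Real.cos_le_cos_of_nonneg_of_le_pi (by positivity) (by nlinarith) (by gcongr)
    linarith [pow_le_pow_of_le_one hq0 hq1.le hcon.le]
  · refine ⟨0, fun u _ _ t ht => ?_⟩
    rw [Nat.le_zero, Finset.card_eq_zero, Finset.eq_empty_iff_forall_notMem]
    intro k hk
    linarith [ht k hk, abs_sub_round (u k)]

theorem exists_decomposition (hθ : IsPisot θ) {G : ℤ → ℝ} (hG : Summable G)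
    (hGr : ∀ k, recur θ G k = if k = 0 then 1 else 0) {δ : ℝ} (hδ : 0 < δ) :
    ∃ m B : ℕ, ∀ n : ℤ, δ ≤ |cosProd (truncate fun k => 2 * n * θ⁻¹ ^ k.toNat)| →
      ∃ c j : Fin m → ℤ, (∀ i, |c i| ≤ B) ∧ (∀ i, 0 ≤ j i) ∧
        |cosProd (truncate fun k => 2 * n * θ⁻¹ ^ k.toNat)| =
          |cosProd fun k => ∑ i, c i * halfLineGreen θ G (j i) k| := by
  classical
  have h1θ := hθ.1
  have h0θ : 0 < θ := by linarith
  set d := (minpoly ℤ θ).natDegree with hd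
  set L := ∑ i ∈ Finset.range (d + 1), |((minpoly ℤ θ).coeff i : ℝ)| with hL
  have hL0 : 0 ≤ L := Finset.sum_nonneg fun _ _ => abs_nonneg _
  -- With `L * ε < 1`, an integer produced by the recurrence from errors at most `ε` must be `0`.
  set ε := 1 / (L + 1) with hε
  have hε0 : 0 < ε := by positivity
  have hεL : L * ε < 1 := by
    rw [hε, mul_one_div, div_lt_one (by positivity)]; linarith
  obtain ⟨M, hM⟩ := exists_card_le hε0 hδ
  obtain ⟨B, hB⟩ := exists_nat_ge L
  refine ⟨(d + 1) * M, B, fun n hn => ?_⟩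
  set u : ℤ → ℝ := truncate fun k => 2 * n * θ⁻¹ ^ k.toNat with hu
  have hus : Summable u := (hasProd_cosProd_truncate (u := fun k : ℤ => 2 * n * θ⁻¹ ^ k.toNat)
    (summable_inv_pow_mul h1θ (2 * n))).1
  have hu_nonneg : ∀ k : ℤ, 0 ≤ k → u k = 2 * n * θ ^ (-k) := by
    intro k hk
    lift k to ℕ using hk
    simp [hu, truncate]
  let e : ℤ → ℝ := fun k => u k - round (u k)
  have he : ∀ k, |e k| ≤ 1 / 2 := fun k => abs_sub_round _
  let N : ℤ → ℤ := fun k => -∑ i ∈ Finset.range (d + 1), (minpoly ℤ θ).coeff i * round (u (k - i))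
  let b : ℤ → ℤ := fun k => if (d : ℤ) ≤ k then N k else 0
  -- The recurrence kills `2nθ⁻ᵏ`, so on `e` it equals minus its value on the nearest integers. It
  -- needs `k ≥ d` because `u` is truncated at `0`.
  have hb : ∀ k : ℤ, (d : ℤ) ≤ k → recur θ e k = b k := by
    intro k hk
    have h1 : recur θ u k = 0 := by
      rw [← recur_zpow hθ (2 * n) k]
      refine Finset.sum_congr rfl fun i hi => ?_
      rw [hu_nonneg _ (by rw [Finset.mem_range] at hi; omega)]
    have h2 := recur_sub (θ := θ) u (fun k => (round (u k) : ℝ)) k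
    rw [h1, zero_sub] at h2
    refine h2.trans ?_
    simp only [b, if_pos hk, N, recur]
    push_cast
    rfl
  have hbL : ∀ k, |b k| ≤ (B : ℤ) := by
    intro k
    by_cases hk : (d : ℤ) ≤ k
    · have h1 := abs_recur_le (θ := θ) (f := e) (k := k) (ε := 1 / 2) fun i _ => he _
      rw [hb k hk] at h1
      have h2 : |(b k : ℝ)| ≤ B := by linarith
      exact_mod_cast h2
    · simp [b, hk]
  have hbad : ∀ k, b k ≠ 0 → (d : ℤ) ≤ k ∧ ∃ i ≤ d, ε ≤ |e (k - i)| := by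
    intro k hk
    have hdk : (d : ℤ) ≤ k := by
      by_contra hcon
      exact hk (if_neg hcon)
    refine ⟨hdk, ?_⟩
    by_contra! hcon
    have h1 := abs_recur_le (θ := θ) (f := e) (k := k) (ε := ε) fun i hi => (hcon i hi).le
    rw [hb k hdk] at h1
    have h2 : |(b k : ℝ)| < 1 := h1.trans_lt hεL
    have h3 : |b k| < 1 := by exact_mod_cast h2
    exact hk (Int.abs_lt_one_iff.1 h3)
  let S : Set ℤ := {k | ε ≤ |e k|}
  have hS : S.Finite := by
    by_contra hinf
    obtain ⟨t, hts, ht⟩ := Set.Infinite.exists_subset_card_eq hinf (M + 1)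
    have := hM u hus hn t fun k hk => hts hk
    omega
  have hScard : hS.toFinset.card ≤ M := hM u hus hn _ fun k hk => by simpa [S] using hk
  -- An index with error at least `ε` can influence `b` only at itself and the next `d` indices;
  -- hence the count `(d + 1) * M`.
  let F₀ : Finset ℤ := (Finset.range (d + 1)).biUnion fun i => hS.toFinset.image fun k => k + i
  let F : Finset ℤ := F₀.filter fun k => b k ≠ 0
  have hmemF : ∀ k, k ∈ F ↔ b k ≠ 0 := by
    intro k
    refine ⟨fun h => (Finset.mem_filter.1 h).2, fun h => Finset.mem_filter.2 ⟨?_, h⟩⟩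
    obtain ⟨-, i, hi, hki⟩ := hbad k h
    refine Finset.mem_biUnion.2 ⟨i, Finset.mem_range.2 (by omega), Finset.mem_image.2
      ⟨k - i, ?_, by ring⟩⟩
    simpa [S] using hki
  have hFcard : F.card ≤ (d + 1) * M := by
    refine (Finset.card_filter_le _ _).trans (Finset.card_biUnion_le.trans ?_)
    refine (Finset.sum_le_card_nsmul _ _ M fun i _ =>
      Finset.card_image_le.trans hScard).trans_eq ?_
    simp
  obtain ⟨c, j, hc, hj, hsum⟩ := exists_fin_enumeration b hbL ((d + 1) * M) F
    (fun k hk => by have := (hbad k ((hmemF k).1 hk)).1; omega) hFcard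
  refine ⟨c, j, hc, hj, ?_⟩
  let E : ℤ → ℝ := fun k => ∑ x ∈ F, b x * G (k - x)
  have hE : ∀ k, recur θ E k = b k := by
    intro k
    rw [recur_sum hGr b F k]
    split_ifs with h
    · rfl
    · rw [hmemF, not_not] at h
      simp [h]
  have hEM : ∀ k, |E k| ≤ ∑ x ∈ F, |(b x : ℝ)| * ∑' k, |G k| := by
    intro k
    refine (Finset.abs_sum_le_sum_abs _ _).trans (Finset.sum_le_sum fun x _ => ?_)
    rw [abs_mul]
    exact mul_le_mul_of_nonneg_left (hG.abs.le_tsum (k - x) fun _ _ => abs_nonneg _) (abs_nonneg _)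
  have hgeo := eq_mul_inv_pow_of_recur_eq_zero hθ (h := fun k => e k - E k)
    (fun k _ => (abs_sub _ _).trans (add_le_add (he k) (hEM k)))
    (fun k hk => by rw [recur_sub, hb k hk, hE, sub_self])
  -- `u 0 = 2n` is an integer. This determines the homogeneous part of `e` as `-E 0 * θ⁻¹ ^ k`,
  -- exactly the correction built into `halfLineGreen`.
  have he0 : e 0 = 0 := by
    have : u 0 = ((2 * n : ℤ) : ℝ) := by rw [hu_nonneg 0 le_rfl]; simp
    simp only [e, this, round_intCast, sub_self]
  have hvs : Summable fun k => ∑ i, (c i : ℝ) * halfLineGreen θ G (j i) k :=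
    summable_sum fun i _ => (summable_halfLineGreen h1θ hG (j i)).mul_left _
  refine abs_cosProd_congr hus hvs fun k => ?_
  rw [← hsum fun x => halfLineGreen θ G x k]
  by_cases hk : 0 ≤ k
  · rw [← abs_cos_pi_mul_sub_int (u k) (round (u k))]
    congr 3
    change e k = _
    lift k to ℕ using hk
    have h1 := hgeo k
    simp only [he0, zero_sub] at h1
    rw [sub_eq_iff_eq_add] at h1
    rw [h1]
    simp only [E, zero_sub, halfLineGreen, truncate, Nat.cast_nonneg, if_true, Int.toNat_natCast]
    rw [neg_mul, Finset.sum_mul, ← Finset.sum_neg_distrib, ← Finset.sum_add_distrib]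
    refine Finset.sum_congr rfl fun x _ => ?_
    ring
  · have h1 : u k = 0 := if_neg hk
    rw [h1]
    simp [halfLineGreen, truncate, hk]

end Decomposition

/-! ### Limits along ultrafilters and clusters of translates -/

section Clusters

theorem eventually_const_or_tendsto_cofinite {α : Type*} (U : Ultrafilter α) (f : α → ℤ) :
    (∃ d, ∀ᶠ n in U, f n = d) ∨ Tendsto f U cofinite := by
  by_cases h : ∃ d, ∀ᶠ n in U, f n = d
  · exact Or.inl h
  · right
    intro s hs
    change ∀ᶠ n in U, f n ∈ s
    by_contra hcon
    rw [← Ultrafilter.eventually_not] at hcon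
    have h1 : ∀ᶠ n in U, ∃ d ∈ sᶜ, f n = d := hcon.mono fun n hn => ⟨f n, hn, rfl⟩
    obtain ⟨d, -, hd⟩ := (Ultrafilter.eventually_exists_mem_iff (mem_cofinite.1 hs)).1 h1
    exact h ⟨d, hd⟩

/-- A combination of translates of a sequence, given by a list of coefficients and translates. -/
def combine (V : ℤ → ℤ → ℝ) (l : List (ℤ × ℤ)) (k : ℤ) : ℝ :=
  (l.map fun a => (a.1 : ℝ) * V a.2 k).sum

theorem exists_combine {ι : Type*} (V : ℤ → ℤ → ℝ) (C : Finset ι) (c d : ι → ℤ) :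
    ∃ l, combine V l = fun k => ∑ i ∈ C, (c i : ℝ) * V (d i) k := by
  refine ⟨C.toList.map fun i => (c i, d i), funext fun k => ?_⟩
  rw [combine, List.map_map]
  exact Finset.sum_map_toList C _

theorem summable_sum_shift {G : ℤ → ℝ} (hG : Summable G) {ι : Type*} (I : Finset ι) (c j : ι → ℤ) :
    Summable fun k => ∑ i ∈ I, (c i : ℝ) * G (k - j i) :=
  summable_sum fun i _ => (summable_shift hG (j i)).mul_left _

theorem abs_sum_shift_le {G : ℤ → ℝ} (hG : Summable G) {ι : Type*} (I : Finset ι) (c j : ι → ℤ)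
    (k : ℤ) : |∑ i ∈ I, (c i : ℝ) * G (k - j i)| ≤ ∑ i ∈ I, |(c i : ℝ)| * ∑' k, |G k| := by
  refine (Finset.abs_sum_le_sum_abs _ _).trans (Finset.sum_le_sum fun i _ => ?_)
  rw [abs_mul]
  exact mul_le_mul_of_nonneg_left (hG.abs.le_tsum (k - j i) fun _ _ => abs_nonneg _) (abs_nonneg _)

theorem tendsto_sum_shift {α : Type*} {l : Filter α} {G : ℤ → ℝ} (hG : Summable G) {ι : Type*}
    (I : Finset ι) (c : ι → ℤ) {j : ι → α → ℤ} (hj : ∀ i ∈ I, Tendsto (j i) l cofinite) (k : ℤ) :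
    Tendsto (fun n => ∑ i ∈ I, (c i : ℝ) * G (k - j i n)) l (𝓝 0) := by
  have h1 : ∀ i ∈ I, Tendsto (fun n => (c i : ℝ) * G (k - j i n)) l (𝓝 0) := by
    intro i hi
    have h2 : Tendsto (fun n => k - j i n) l cofinite :=
      (sub_right_injective (b := k)).tendsto_cofinite.comp (hj i hi)
    simpa using (hG.tendsto_cofinite_zero.comp h2).const_mul (c i : ℝ)
  simpa using tendsto_finsetSum I h1

/-- Products over well separated clusters of translates. -/
def clusterValue (G : ℤ → ℝ) (L : List (List (ℤ × ℤ))) : ℝ :=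
  (L.map fun l => cosProd (combine (fun j k => G (k - j)) l)).prod

/-- Along an ultrafilter, the cosine product of a combination of a fixed number of translates
converges to a product over clusters. -/
theorem exists_tendsto_cosProd_sum_shift {α : Type*} (U : Ultrafilter α) {G : ℤ → ℝ}
    (hG : Summable G) {ι : Type*} (c : ι → ℤ) (j : ι → α → ℤ) (I : Finset ι) :
    ∃ L, Tendsto (fun n => cosProd fun k => ∑ i ∈ I, (c i : ℝ) * G (k - j i n)) U
      (𝓝 (clusterValue G L)) := by
  classical
  induction I using Finset.strongInduction with
  | H I ih =>
    rcases I.eq_empty_or_nonempty with rfl | ⟨i₀, hi₀⟩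
    · refine ⟨[], ?_⟩
      simp [clusterValue, cosProd]
    -- The cluster of `i₀`: translates at eventually constant offset from it. Seen from `j i₀`, all
    -- others escape to infinity, so the cluster's product splits off and induction handles the
    -- rest.
    let C := I.filter fun i => ∃ d, ∀ᶠ n in U, j i n - j i₀ n = d
    let R := I.filter fun i => ¬ ∃ d, ∀ᶠ n in U, j i n - j i₀ n = d
    have hR : R ⊂ I := by
      refine Finset.filter_ssubset.2 ⟨i₀, hi₀, ?_⟩
      simp
    obtain ⟨L, hL⟩ := ih R hR
    have hd : ∀ i, ∃ d, i ∈ C → ∀ᶠ n in U, j i n - j i₀ n = d := by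
      intro i
      by_cases hi : i ∈ C
      · exact (Finset.mem_filter.1 hi).2.imp fun d hd _ => hd
      · exact ⟨0, fun h => absurd h hi⟩
    choose d hd using hd
    obtain ⟨l, hl⟩ := exists_combine (fun j k => G (k - j)) C c d
    refine ⟨l :: L, ?_⟩
    have hshift : ∀ (I : Finset ι) n, cosProd (fun k => ∑ i ∈ I, (c i : ℝ) * G (k - j i n)) =
        cosProd (fun k => ∑ i ∈ I, (c i : ℝ) * G (k - (j i n - j i₀ n))) := by
      intro I n
      refine Eq.trans ?_ (cosProd_shift (fun k => ∑ i ∈ I, (c i : ℝ) * G (k - (j i n - j i₀ n)))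
        (j i₀ n))
      congr 1; funext k
      refine Finset.sum_congr rfl fun i _ => ?_
      congr 2; ring
    have hev : ∀ᶠ n in U, ∀ i ∈ C, j i n - j i₀ n = d i :=
      (Filter.eventually_all_finset C).2 fun i hi => hd i hi
    have l1 := tendsto_cosProd_add_sub_mul (l := (U : Filter α))
      (v := fun n k => ∑ i ∈ R, (c i : ℝ) * G (k - (j i n - j i₀ n)))
      (summable_sum_shift hG C c d) (fun n => summable_sum_shift hG R c _)
      (fun n => abs_sum_shift_le hG R c _) (tendsto_sum_shift hG R c fun i hi =>
        (eventually_const_or_tendsto_cofinite U _).resolve_left (Finset.mem_filter.1 hi).2)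
    have l2 := l1.add (hL.const_mul (cosProd fun k => ∑ i ∈ C, (c i : ℝ) * G (k - d i)))
    rw [zero_add] at l2
    have e : clusterValue G (l :: L) =
        cosProd (fun k => ∑ i ∈ C, (c i : ℝ) * G (k - d i)) * clusterValue G L := by
      rw [clusterValue, List.map_cons, List.prod_cons, hl]
      rfl
    rw [e]
    refine l2.congr' ?_
    filter_upwards [hev] with n hn
    rw [hshift I n, hshift R n, sub_add_cancel]
    congr 1; funext k
    rw [← Finset.sum_filter_add_sum_filter_not I
      (fun i => ∃ d, ∀ᶠ n in U, j i n - j i₀ n = d)]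
    congr 1
    exact Finset.sum_congr rfl fun i hi => by rw [hn i hi]

theorem exists_tendsto_cosProd_sum_halfLineGreen {α : Type*} (U : Ultrafilter α) {θ : ℝ}
    (hθ : 1 < θ) {G : ℤ → ℝ} (hG : Summable G) {ι : Type*} (c : ι → ℤ) (j : ι → α → ℤ)
    (I : Finset ι) (hj : ∀ᶠ n in U, ∀ i, 0 ≤ j i n) :
    ∃ l L, Tendsto (fun n => cosProd fun k => ∑ i ∈ I, (c i : ℝ) * halfLineGreen θ G (j i n) k) U
      (𝓝 (cosProd (combine (halfLineGreen θ G) l) * clusterValue G L)) := by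
  classical
  -- Translates with constant position keep feeling the boundary at `0`. The others tend to `+∞`,
  -- since positions are nonnegative, and there `halfLineGreen` may be replaced by a plain translate
  -- of `G`.
  let C := I.filter fun i => ∃ d, ∀ᶠ n in U, j i n = d
  let R := I.filter fun i => ¬ ∃ d, ∀ᶠ n in U, j i n = d
  have hd : ∀ i, ∃ d, i ∈ C → ∀ᶠ n in U, j i n = d := by
    intro i
    by_cases hi : i ∈ C
    · exact (Finset.mem_filter.1 hi).2.imp fun d hd _ => hd
    · exact ⟨0, fun h => absurd h hi⟩
  choose d hd using hd
  obtain ⟨l, hl⟩ := exists_combine (halfLineGreen θ G) C c d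
  obtain ⟨L, hL⟩ := exists_tendsto_cosProd_sum_shift U hG c j R
  refine ⟨l, L, ?_⟩
  rw [hl]
  have hcof : ∀ i ∈ R, Tendsto (j i) U cofinite := fun i hi =>
    (eventually_const_or_tendsto_cofinite U _).resolve_left (Finset.mem_filter.1 hi).2
  have htop : ∀ i ∈ R, Tendsto (j i) U atTop := by
    intro i hi
    refine tendsto_atTop.2 fun b => ?_
    filter_upwards [hj, (hcof i hi).eventually (Set.finite_Icc 0 b).eventually_cofinite_notMem]
      with n h1 h2
    by_contra hcon
    exact h2 ⟨h1 i, (not_le.1 hcon).le⟩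
  have hHs : ∀ (I : Finset ι) (j : ι → ℤ),
      Summable fun k => ∑ i ∈ I, (c i : ℝ) * halfLineGreen θ G (j i) k := fun I j =>
    summable_sum fun i _ => (summable_halfLineGreen hθ hG (j i)).mul_left _
  set u : ℤ → ℝ := fun k => ∑ i ∈ C, (c i : ℝ) * halfLineGreen θ G (d i) k with hu
  have hus : Summable u := hHs C d
  have l0 : Tendsto (fun n => ∑' k, |(u k + ∑ i ∈ R, (c i : ℝ) * halfLineGreen θ G (j i n) k) -
      (u k + ∑ i ∈ R, (c i : ℝ) * G (k - j i n))|) U (𝓝 0) := by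
    have hi : ∀ i ∈ R, Tendsto (fun n => |(c i : ℝ)| *
        ∑' k, |halfLineGreen θ G (j i n) k - G (k - j i n)|) U (𝓝 0) := by
      intro i hi
      have h1 : Tendsto (fun n => -G (-j i n)) U (𝓝 0) := by
        have := hG.tendsto_cofinite_zero.comp
          ((neg_injective (G := ℤ)).tendsto_cofinite.comp (hcof i hi))
        simpa using this.neg
      have h2 := (tendsto_tsum_abs_truncate_shift hθ hG (htop i hi) h1).const_mul |(c i : ℝ)|
      rwa [mul_zero] at h2
    have hlim := tendsto_finsetSum R hi
    rw [Finset.sum_const_zero] at hlim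
    refine squeeze_zero (fun n => tsum_nonneg fun k => abs_nonneg _) (fun n => ?_) hlim
    have hsi : ∀ i ∈ R, Summable fun k =>
        |(c i : ℝ)| * |halfLineGreen θ G (j i n) k - G (k - j i n)| := fun i _ =>
      ((summable_halfLineGreen hθ hG (j i n)).sub (summable_shift hG (j i n))).abs.mul_left _
    simp only [← tsum_mul_left]
    rw [← Summable.tsum_finsetSum hsi]
    have hle : ∀ k, |(u k + ∑ i ∈ R, (c i : ℝ) * halfLineGreen θ G (j i n) k) -
        (u k + ∑ i ∈ R, (c i : ℝ) * G (k - j i n))| ≤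
        ∑ i ∈ R, |(c i : ℝ)| * |halfLineGreen θ G (j i n) k - G (k - j i n)| := by
      intro k
      rw [add_sub_add_left_eq_sub, ← Finset.sum_sub_distrib]
      refine (Finset.abs_sum_le_sum_abs _ _).trans (Finset.sum_le_sum fun i _ => ?_)
      rw [← mul_sub, abs_mul]
    exact ((summable_sum hsi).of_nonneg_of_le (fun _ => abs_nonneg _) hle).tsum_le_tsum hle
      (summable_sum hsi)
  have l1 := tendsto_cosProd_sub (fun n => hus.add (hHs R fun i => j i n))
    (fun n => hus.add (summable_sum_shift hG R c fun i => j i n)) l0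
  have l2 := tendsto_cosProd_add_sub_mul (l := (U : Filter α)) hus
    (v := fun n k => ∑ i ∈ R, (c i : ℝ) * G (k - j i n))
    (fun n => summable_sum_shift hG R c _) (fun n => abs_sum_shift_le hG R c _)
    (tendsto_sum_shift hG R c hcof)
  have l3 := (l1.add l2).add (hL.const_mul (cosProd u))
  rw [zero_add, zero_add] at l3
  refine l3.congr' ?_
  have hev : ∀ᶠ n in U, ∀ i ∈ C, j i n = d i :=
    (Filter.eventually_all_finset C).2 fun i hi => hd i hi
  filter_upwards [hev] with n hn
  have e : (fun k => ∑ i ∈ I, (c i : ℝ) * halfLineGreen θ G (j i n) k) =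
      fun k => u k + ∑ i ∈ R, (c i : ℝ) * halfLineGreen θ G (j i n) k := by
    funext k
    rw [← Finset.sum_filter_add_sum_filter_not I (fun i => ∃ d, ∀ᶠ n in U, j i n = d)]
    congr 1
    exact Finset.sum_congr rfl fun i hi => by rw [hn i hi]
  rw [e]
  ring

end Clusters

/-- Every nonzero limit point is, up to sign, a cosine product coded by finite lists of integers.
The sign is lost because reduction to the nearest integer preserves only the modulus of each cosine.
-/
theorem limitPoints_countable {θ : ℝ} (hθ : IsPisot θ) :
    (limitPoints (measureFourierCoeff (circleBernoulli θ))).Countable := by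
  have h1θ := hθ.1
  obtain ⟨G, hG, hGr⟩ := exists_green hθ
  let W : Set ℝ := Set.range fun x : List (ℤ × ℤ) × List (List (ℤ × ℤ)) =>
    cosProd (combine (halfLineGreen θ G) x.1) * clusterValue G x.2
  have hW : W.Countable := Set.countable_range _
  refine ((Set.countable_singleton (0 : ℂ)).union ((hW.image ((↑) : ℝ → ℂ)).union
    (hW.image fun x => ((-x : ℝ) : ℂ)))).mono ?_
  intro z hz
  obtain ⟨U, -, hU⟩ := mapClusterPt_iff_ultrafilter.1 (mem_limitPoints_iff.1 hz)
  by_cases hz0 : z = 0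
  · exact Or.inl hz0
  right
  replace hU := hU.congr (measureFourierCoeff_eq_cosProd h1θ)
  have hre : Tendsto (fun n : ℤ => cosProd (truncate fun k => 2 * n * θ⁻¹ ^ k.toNat)) U
      (𝓝 z.re) := by
    exact (Complex.continuous_re.tendsto z).comp hU
  have him : z.im = 0 := by
    have h1 : Tendsto (fun _ : ℤ => (0 : ℝ)) U (𝓝 z.im) := by
      simpa [Function.comp_def] using (Complex.continuous_im.tendsto z).comp hU
    exact tendsto_nhds_unique h1 tendsto_const_nhds
  have hzre : z = (z.re : ℂ) := Complex.ext rfl (by simpa using him)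
  have hre0 : 0 < |z.re| := by
    rw [abs_pos]
    intro h
    exact hz0 (by rw [hzre, h]; simp)
  obtain ⟨m, B, hdec⟩ := exists_decomposition hθ hG hGr (half_pos hre0)
  choose! c j hc hj hcj using hdec
  have hev : ∀ᶠ n : ℤ in U, |z.re| / 2 ≤ |cosProd (truncate fun k => 2 * n * θ⁻¹ ^ k.toNat)| :=
    hre.abs.eventually_const_le (half_lt_self hre0)
  -- The coefficient vectors range over a finite box, so an ultrafilter selects one of them.
  obtain ⟨c₀, hc₀⟩ : ∃ c₀, ∀ᶠ n in U, c n = c₀ := by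
    have hfin : (Set.univ.pi fun _ : Fin m => Set.Icc (-(B : ℤ)) B).Finite :=
      Set.Finite.pi fun _ => Set.finite_Icc _ _
    have h1 : ∀ᶠ n in U, ∃ x ∈ (Set.univ.pi fun _ : Fin m => Set.Icc (-(B : ℤ)) B), c n = x := by
      filter_upwards [hev] with n hn
      exact ⟨c n, fun i _ => abs_le.1 (hc n hn i), rfl⟩
    obtain ⟨x, -, hx⟩ := (Ultrafilter.eventually_exists_mem_iff hfin).1 h1
    exact ⟨x, hx⟩
  obtain ⟨l, L, hlim⟩ := exists_tendsto_cosProd_sum_halfLineGreen U h1θ hG c₀ (fun i n => j n i)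
    Finset.univ (by filter_upwards [hev] with n hn using hj n hn)
  have habs : |z.re| = |cosProd (combine (halfLineGreen θ G) l) * clusterValue G L| := by
    refine tendsto_nhds_unique hre.abs (hlim.abs.congr' ?_)
    filter_upwards [hev, hc₀] with n hn hcn
    rw [hcj n hn, hcn]
  rcases abs_eq_abs.1 habs with h | h
  · exact Or.inl ⟨_, ⟨(l, L), rfl⟩, by rw [hzre, h]⟩
  · exact Or.inr ⟨_, ⟨(l, L), rfl⟩, by rw [hzre, h]⟩

end BernoulliConv

end

theorem theorem1 (θ : ℝ) (hθ : BernoulliConv.IsPisot θ) (hirr : Irrational θ) :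
    (BernoulliConv.limitPoints
        (BernoulliConv.measureFourierCoeff (BernoulliConv.circleBernoulli θ))).Countable ∧
      (BernoulliConv.limitPoints
        (BernoulliConv.measureFourierCoeff (BernoulliConv.circleBernoulli θ))).Infinite ∧
      ∀ (p : ℝ≥0∞) [Fact (1 ≤ p)], 1 < p → p < ∞ →
        spectrum ℂ (BernoulliConv.convOp (BernoulliConv.circleBernoulli θ) p) =
            spectrum ℂ (BernoulliConv.convOp (BernoulliConv.circleBernoulli θ) 2) ∧
          spectrum ℂ (BernoulliConv.convOp (BernoulliConv.circleBernoulli θ) 2) =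
            closure (Set.range
              (BernoulliConv.measureFourierCoeff (BernoulliConv.circleBernoulli θ))) := by
  have hcount := BernoulliConv.limitPoints_countable hθ
  -- The closure consists of the values and the limit points, so it is countable.
  have hK := ((Set.countable_range (BernoulliConv.measureFourierCoeff
    (BernoulliConv.circleBernoulli θ))).union hcount).mono (BernoulliConv.closure_range_subset _)
  have h2 := BernoulliConv.spectrum_convOp_eq_closure_range (BernoulliConv.circleBernoulli θ) hK 2
    ENNReal.one_lt_two ENNReal.ofNat_lt_top
  refine ⟨hcount, BernoulliConv.limitPoints_infinite hθ hirr, fun p _ h1p hp => ⟨?_, h2⟩⟩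
  rw [h2]
  exact BernoulliConv.spectrum_convOp_eq_closure_range _ hK p h1p hp
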